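/- For graphs $G,T,H$ let $\mathcal N(G,T)$ be the number of copies of $T$ in $G$ (subgraphs of $G$ isomorphic to $T$), and let $\mathrm{ex}(n,T,H)$ be the maximum of $\mathcal N(G,T)$ over all $n$-vertex graphs $G$ containing no copy of $H$. Let $T_r(n)$ be the Turán graph, i.e. the complete balanced $r$-partite graph on $n$ vertices. For integers $r\ge 2$ and $t\ge s\ge 1$ let $K^{(r)}_{s,t}$ be the complete $r$-partite graph with one part of size $t$ and the other $r-1$ parts of size $s$. Then the following hold. (a) If $t<s+\frac12+\sqrt{2s+\frac14}$, then for all sufficiently large $n$ (depending on $r,s,t$) the Turán graph $T_r(n)$ is, up to isomorphism, the unique $n$-vertex $K_{r+1}$-free graph that maximizes the number of copies of $K^{(r)}_{s,t}$. (b) If $t=s+\frac12+\sqrt{2s+\frac14}$, then $\mathrm{ex}(n,K^{(r)}_{s,t},K_{r+1})=(1+o(1))\cdot\mathcal N(T_r(n),K^{(r)}_{s,t})$ as $n\to\infty$. Moreover, if $r=2$, then $\mathrm{ex}(n,K_{s,t},K_3)\ge \mathcal N(T_2(n),K_{s,t})+\Omega(n^{s+t-2})$; that is, there is a constant $c=c(s,t)>0$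 such that $\mathrm{ex}(n,K_{s,t},K_3)\ge \mathcal N(T_2(n),K_{s,t})+c\,n^{s+t-2}$ for all sufficiently large $n$. (c) If $t>s+\frac12+\sqrt{rs+\frac14}$, then there is a constant $c=c(r,s,t)>0$ such that $\mathrm{ex}(n,K^{(r)}_{s,t},K_{r+1})\ge(1+c)\cdot\mathcal N(T_r(n),K^{(r)}_{s,t})$ for every $n$. -/

import Mathlib

open Filter Asymptotics

/-- `ex(n, T, H)`: the maximum number of copies of `T` (subgraphs isomorphic to `T`) in an
`H`-free graph on `n` vertices (and `0` if no graph on `n` vertices is `H`-free). -/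
noncomputable def genEx (n : ℕ) {α β : Type*} (T : SimpleGraph α) (H : SimpleGraph β) : ℕ :=
  open scoped Classical in
  (Finset.univ.filter fun G : SimpleGraph (Fin n) => H.Free G).sup fun G => G.copyCount T

/-- `K^{(r)}_{s,t}`: the complete `r`-partite graph with one part of size `t` and the other
`r - 1` parts of size `s`. -/
abbrev multipartiteK (r s t : ℕ) :
    SimpleGraph (Σ i : Fin r, Fin (if (i : ℕ) = 0 then t else s)) :=
  SimpleGraph.completeMultipartiteGraph fun i : Fin r => Fin (if (i : ℕ) = 0 then t else s)

/-- `N(T_r(n), K^{(r)}_{s,t})`: the number of copies of `K^{(r)}_{s,t}` in the Turán graph. -/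
noncomputable def turanCount (n r s t : ℕ) : ℕ :=
  (SimpleGraph.turanGraph n r).copyCount (multipartiteK r s t)

/-!
Write `d = t - s`. Let `T` be the complete `r`-partite graph with part sizes `t, s, …, s`.

*Reduction to part sizes.* Zykov symmetrization applies to `T`, because nonadjacent vertices of `T`
have the same neighbours: for nonadjacent `u` and `v`, making `v` a twin of `u` or making `u` a twin
of `v` does not lower the number of copies on average (`two_mul_labelledCopyCount_le`). Hence in an
extremal graph either operation gives an extremal graph again, and since one of them increases the
number of pairs of twins, some extremal graph is complete multipartite
(`exists_isCopyMaximal_colorGraph`). Reversing the last step of such a process shows that every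
extremal graph is complete multipartite, provided that in the complete multipartite ones every edge
lies in a copy of `T` (`IsCopyMaximal.eq_colorGraph_of_cloneVertex`).

In a complete `r`-partite graph with part sizes `ν i`, the number of copies of `T` is a constant
times `partWeight s d ν = (∏ i, (ν i)ₛ) * ∑ i, (ν i - s)_d`, where `(x)ₖ` is the falling factorial.
So it remains to maximize `partWeight` for a given sum of the part sizes. If two equal parts of
relative size one are changed to `1 + u` and `1 - u`, the first factor changes by `(1 - u ^ 2) ^ s`
and the two terms of the sum change by the even part of `(1 + u) ^ d`, which lies between
`1 + d.choose 2 * u ^ 2` and `(1 + u ^ 2) ^ d.choose 2`. The three regimes of the theorem are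
`d.choose 2 < s`, `d.choose 2 = s` and `2 * d.choose 2 > r * s`.

* For `d.choose 2 < s`, moving one vertex from a largest part to a smallest part increases the
  weight whenever the parts are not balanced and `n` is large
  (`eventually_exists_partWeight_lt`). Thus the extremal graphs are the Turán graphs.
* For `d.choose 2 ≤ s`, the leading term `partDensity` of the weight is maximal at equal parts
  (`partDensity_le_of_mem_stdSimplex`), which gives the asymptotic statement. For `r = 2` and
  `d.choose 2 = s`, the second-order terms cancel only up to a relative error that favours unequal
  parts: a deviation of order `√n` gains a factor `1 + Ω(n⁻²)` (`centeredWeight_gain`).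
* For `2 * d.choose 2 > r * s`, equal parts are not optimal: for large `n` a fixed relative
  deviation gains a constant factor (`eventually_exists_mul_partWeight_le`), and for each `n` moving
  a single vertex gives a strict improvement (`exists_partWeight_lt_of_isBalanced`).
-/

namespace SimpleGraph

/-! ### Labelled and unlabelled copies -/

section Copies

variable {V W : Type*}

theorem finite_iso [Finite V] [Finite W] (G : SimpleGraph V) (H : SimpleGraph W) :
    Finite (G ≃g H) :=
  Finite.of_injective (fun e : G ≃g H => (e : V → W)) DFunLike.coe_injective

/-- The copies with a given underlying subgraph form a torsor under the automorphisms of `H`. -/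
theorem labelledCopyCount_eq_copyCount_mul [Fintype V] [Fintype W] (G : SimpleGraph V)
    (H : SimpleGraph W) : G.labelledCopyCount H = G.copyCount H * Nat.card (H ≃g H) := by
  classical
  have := finite_iso H H
  have := Fintype.ofFinite (H ≃g H)
  have hmaps : ∀ f ∈ (Finset.univ : Finset (Copy H G)), f.toSubgraph ∈
      ({G' : G.Subgraph | Nonempty (H ≃g G'.coe)} : Finset G.Subgraph) := fun f _ => by
    simpa using ⟨f.isoToSubgraph⟩
  rw [labelledCopyCount, copyCount, Nat.card_eq_fintype_card]
  have h1 := Finset.card_eq_sum_card_fiberwise hmaps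
  rw [Finset.card_univ] at h1
  convert h1 using 1
  symm
  refine Finset.sum_const_nat fun G' hG' => ?_
  obtain ⟨e⟩ := (Finset.mem_filter.1 hG').2
  rw [← Finset.card_univ]
  symm
  refine Finset.card_bij (fun σ _ => G'.coeCopy.comp (e.toCopy.comp σ.toCopy)) ?_ ?_ ?_
  · intro σ _
    simp only [Finset.mem_filter, Finset.mem_univ, true_and]
    have : (G'.coeCopy.comp (e.toCopy.comp σ.toCopy)).toHom = G'.hom.comp (e.comp σ).toHom := rfl
    rw [Copy.toSubgraph, this]
    simp [Subgraph.map_comp]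
  · intro σ _ τ _ h
    ext x
    have := DFunLike.congr_fun h x
    exact e.injective (Subtype.ext this)
  · intro f hf
    simp only [Finset.mem_filter, Finset.mem_univ, true_and] at hf
    subst hf
    refine ⟨e.symm.comp f.isoToSubgraph, Finset.mem_univ _, ?_⟩
    ext x
    change ((e (e.symm (f.isoToSubgraph x)) : f.toSubgraph.verts) : V) = f x
    rw [e.apply_symm_apply]
    rfl

theorem copyCount_congr_iso [Fintype V] {V' : Type*} [Fintype V'] [Fintype W] {G : SimpleGraph V}
    {G' : SimpleGraph V'} (e : G ≃g G') (H : SimpleGraph W) : G.copyCount H = G'.copyCount H := by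
  classical
  have hL : G.labelledCopyCount H = G'.labelledCopyCount H := by
    refine Fintype.card_congr
      ⟨fun f => e.toCopy.comp f, fun f => e.symm.toCopy.comp f, fun f => ?_, fun f => ?_⟩
    · ext x; exact e.symm_apply_apply _
    · ext x; exact e.apply_symm_apply _
  rw [labelledCopyCount_eq_copyCount_mul, labelledCopyCount_eq_copyCount_mul] at hL
  have := finite_iso H H
  exact Nat.eq_of_mul_eq_mul_right (Nat.card_pos (α := H ≃g H)) hL

theorem labelledCopyCount_eq_card_filter [Fintype V] [Fintype W] (G : SimpleGraph V)
    (H : SimpleGraph W) [DecidablePred fun f : W ↪ V => ∀ a b, H.Adj a b → G.Adj (f a) (f b)]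
    [Fintype (W ↪ V)] : G.labelledCopyCount H =
      (Finset.univ.filter fun f : W ↪ V => ∀ a b, H.Adj a b → G.Adj (f a) (f b)).card := by
  classical
  rw [labelledCopyCount, ← Fintype.card_subtype]
  exact Fintype.card_congr
    ⟨fun f => ⟨f.toEmbedding, fun a b h => f.toHom.map_adj h⟩,
      fun f => ⟨⟨f.1, fun {a b} h => f.2 a b h⟩, f.1.injective⟩, fun f => rfl, fun f => rfl⟩

theorem labelledCopyCount_lt_of_copy [Fintype V] [Fintype W] {G G' : SimpleGraph V}
    {H : SimpleGraph W} (hle : G ≤ G') (f : Copy H G') {a b : W} (hab : H.Adj a b)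
    (hf : ¬ G.Adj (f a) (f b)) : G.labelledCopyCount H < G'.labelledCopyCount H := by
  classical
  rw [labelledCopyCount_eq_card_filter, labelledCopyCount_eq_card_filter]
  refine Finset.card_lt_card ⟨fun g hg => ?_, fun h => ?_⟩
  · exact Finset.mem_filter.2 ⟨Finset.mem_univ _, fun a b h =>
      hle ((Finset.mem_filter.1 hg).2 a b h)⟩
  · have := h (Finset.mem_filter.2 ⟨Finset.mem_univ f.toEmbedding,
      fun a b h => f.toHom.map_adj h⟩)
    exact hf ((Finset.mem_filter.1 this).2 a b hab)

end Copies

/-! ### Copies of a complete multipartite graph in a complete multipartite graph -/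

section ColorGraph

variable {V ι : Type*}

/-- The complete multipartite graph whose parts are the colour classes of `c`; a class may be
empty. -/
abbrev colorGraph (c : V → ι) : SimpleGraph V := (⊤ : SimpleGraph ι).comap c

/-- The copy of a complete multipartite graph that embeds the part `p` into the colour class
`π p`. -/
def copyOfPerm {P : ι → Type*} {c : V → ι} (π : Equiv.Perm ι)
    (g : ∀ p, P p ↪ {x // c x = π p}) : Copy (completeMultipartiteGraph P) (colorGraph c) where
  toHom := ⟨fun a => (g a.1 a.2).1, fun {a b} h => by
    rw [comap_adj, top_adj, (g a.1 a.2).2, (g b.1 b.2).2]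
    exact fun h' => h (π.injective h')⟩
  injective' := by
    rintro ⟨p, x⟩ ⟨q, y⟩ h
    change (g p x).1 = (g q y).1 at h
    obtain rfl : p = q := π.injective (by rw [← (g p x).2, ← (g q y).2, h])
    rw [(g p).injective (Subtype.ext h)]

/-- A copy of a complete multipartite graph with nonempty parts in a complete multipartite graph
with equally many classes matches the parts with the classes. -/
theorem bijective_copyOfPerm [Finite ι] (P : ι → Type*) [∀ i, Nonempty (P i)] (c : V → ι) :
    Function.Bijective fun g : (Σ π : Equiv.Perm ι, ∀ p, P p ↪ {x // c x = π p}) =>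
      copyOfPerm g.1 g.2 := by
  constructor
  · rintro ⟨π, g⟩ ⟨τ, g'⟩ h
    have hp : ∀ p x, (g p x).1 = (g' p x).1 := fun p x =>
      congrArg (fun f : Copy (completeMultipartiteGraph P) (colorGraph c) => f ⟨p, x⟩) h
    obtain rfl : π = τ := by
      ext p
      obtain ⟨x⟩ := ‹∀ i, Nonempty (P i)› p
      rw [← (g p x).2, hp, (g' p x).2]
    congr
    ext p x
    exact hp p x
  · intro f
    let a : ∀ p, P p := fun p => Classical.arbitrary _
    have hadj : ∀ p x q y, p ≠ q → c (f ⟨p, x⟩) ≠ c (f ⟨q, y⟩) := fun p x q y hpq =>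
      f.toHom.map_adj (v := ⟨p, x⟩) (w := ⟨q, y⟩) hpq
    have hinj : Function.Injective fun p => c (f ⟨p, a p⟩) := fun p q h => by
      by_contra hpq
      exact hadj _ _ _ _ hpq h
    let π : Equiv.Perm ι := Equiv.ofBijective _ (Finite.injective_iff_bijective.1 hinj)
    have hπ : ∀ p x, c (f ⟨p, x⟩) = π p := fun p x => by
      obtain ⟨q, hq⟩ := π.surjective (c (f ⟨p, x⟩))
      by_cases hpq : p = q
      · rw [← hq, hpq]
      · exact absurd hq.symm (hadj _ _ _ _ hpq)
    refine ⟨⟨π, fun p => ⟨fun x => ⟨f ⟨p, x⟩, hπ p x⟩, fun x y h => ?_⟩⟩, ?_⟩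
    · have := f.injective (congrArg Subtype.val h)
      simpa using this
    · ext ⟨p, x⟩
      rfl

theorem labelledCopyCount_colorGraph [Fintype V] [Fintype ι] [DecidableEq ι] (P : ι → Type*)
    [∀ i, Fintype (P i)] [∀ i, Nonempty (P i)] (c : V → ι) :
    (colorGraph c).labelledCopyCount (completeMultipartiteGraph P) =
      ∑ π : Equiv.Perm ι, ∏ p, (Fintype.card {x // c x = π p}).descFactorial
        (Fintype.card (P p)) := by
  classical
  have h := Nat.card_congr (Equiv.ofBijective _ (bijective_copyOfPerm P c))
  rw [Nat.card_eq_fintype_card (α := Copy _ _), Nat.card_eq_fintype_card, Fintype.card_sigma] at h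
  rw [labelledCopyCount]
  refine Eq.trans ?_ (h.symm.trans ?_)
  · convert rfl
  · refine Finset.sum_congr rfl fun π _ => ?_
    rw [Fintype.card_pi]
    exact Finset.prod_congr rfl fun p _ => Fintype.card_embedding_eq

end ColorGraph

/-- Up to a constant factor, the number of copies of the complete `r`-partite graph with one part
of size `s + d` and `r - 1` parts of size `s` in a complete `r`-partite graph with parts of
sizes `ν i`: the first factor places `s` vertices into every part, and the second one places the
`d` remaining vertices into one part. -/
def partWeight {ι : Type*} [Fintype ι] (s d : ℕ) (ν : ι → ℕ) : ℕ :=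
  (∏ i, (ν i).descFactorial s) * ∑ i, (ν i - s).descFactorial d

/-- The sum over all matchings of the parts with the classes collapses: the large part can go to
any class, and each choice of that class extends to `k!` matchings. -/
theorem labelledCopyCount_multipartiteK {V : Type*} [Fintype V] (k s d : ℕ) (hs : 1 ≤ s)
    (c : V → Fin (k + 1)) :
    (colorGraph c).labelledCopyCount (multipartiteK (k + 1) s (s + d)) =
      k.factorial * partWeight s d fun i => Fintype.card {x // c x = i} := by
  have : ∀ i : Fin (k + 1), Nonempty (Fin (if (i : ℕ) = 0 then s + d else s)) := fun i =>
    ⟨⟨0, by split_ifs <;> omega⟩⟩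
  rw [labelledCopyCount_colorGraph]
  set ν : Fin (k + 1) → ℕ := fun i => Fintype.card {x // c x = i} with hν
  have key : ∀ π : Equiv.Perm (Fin (k + 1)), (∏ p, (Fintype.card {x // c x = π p}).descFactorial
        (Fintype.card (Fin (if (p : ℕ) = 0 then s + d else s)))) =
      (∏ i, (ν i).descFactorial s) * (ν (π 0) - s).descFactorial d := fun π => by
    rw [← Equiv.prod_comp π (fun i => (ν i).descFactorial s), Fin.prod_univ_succ,
      Fin.prod_univ_succ]
    have h0 := Nat.descFactorial_mul_descFactorial (n := ν (π 0)) (Nat.le_add_right s d)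
    rw [Nat.add_sub_cancel_left] at h0
    simp only [Fintype.card_fin, Fin.val_zero, if_true, Fin.val_succ, Nat.succ_ne_zero, if_false]
    rw [show Fintype.card {x // c x = π 0} = ν (π 0) from rfl, ← h0]
    simp only [hν]
    ring
  rw [Finset.sum_congr rfl fun π _ => key π, ← Finset.mul_sum, partWeight]
  have hsum : ∑ π : Equiv.Perm (Fin (k + 1)), (ν (π 0) - s).descFactorial d =
      k.factorial * ∑ i, (ν i - s).descFactorial d := by
    rw [← Equiv.sum_comp Equiv.Perm.decomposeFin.symm, Fintype.sum_prod_type]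
    simp only [Equiv.Perm.decomposeFin_symm_apply_zero, Finset.sum_const, Finset.card_univ,
      Fintype.card_perm, Fintype.card_fin, smul_eq_mul, Finset.mul_sum]
  rw [hsum]
  ring

/-! ### Zykov symmetrization -/

section Zykov

variable {V W : Type*}

theorem Free.comap_top {U : Type*} {m : ℕ} {G : SimpleGraph V}
    (h : (⊤ : SimpleGraph (Fin m)).Free G) (π : U → V) :
    (⊤ : SimpleGraph (Fin m)).Free (G.comap π) := by
  rintro ⟨f⟩
  let g : (⊤ : SimpleGraph (Fin m)) →g G := (Hom.comap π G).comp f.toHom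
  exact h ⟨g.toCopy g.injective_of_top_hom⟩

variable [DecidableEq V]

/-- The graph in which the neighbourhood of `v` is replaced by the neighbourhood of `u`. It is
written as a pullback, so that homomorphisms into it are easy to describe; if `u` and `v` are not
adjacent it is the same graph as `G.replaceVertex u v`. -/
abbrev cloneVertex (G : SimpleGraph V) (u v : V) : SimpleGraph V :=
  G.comap (Function.update id v u)

/-- Cloning `u` over `v` or `v` over `u` does not lower the number of copies on average. The sum
over all injections `f : W ↪ V` is compared term by term, after pairing `f` with its composition
with the transposition of `u` and `v`. -/
theorem two_mul_labelledCopyCount_le [Fintype V] [Fintype W] (G : SimpleGraph V)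
    {H : SimpleGraph W} (hH : H.IsCompleteMultipartite) {u v : V} (huv : ¬ G.Adj u v)
    (hne : u ≠ v) :
    2 * G.labelledCopyCount H ≤
      (G.cloneVertex u v).labelledCopyCount H + (G.cloneVertex v u).labelledCopyCount H := by
  classical
  simp only [labelledCopyCount_eq_card_filter, Finset.card_filter]
  let σ : (W ↪ V) ≃ (W ↪ V) := Equiv.embeddingCongr (Equiv.refl W) (Equiv.swap u v)
  have hσ : ∀ (f : W ↪ V) a, σ f a = Equiv.swap u v (f a) := fun f a => by
    rfl
  set p : (W ↪ V) → Prop := fun f => ∀ a b, H.Adj a b → G.Adj (f a) (f b) with hp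
  set p1 : (W ↪ V) → Prop := fun f => ∀ a b, H.Adj a b → (G.cloneVertex u v).Adj (f a) (f b)
    with hp1
  set p2 : (W ↪ V) → Prop := fun f => ∀ a b, H.Adj a b → (G.cloneVertex v u).Adj (f a) (f b)
    with hp2
  have hpt : ∀ f : W ↪ V, (if p f then 1 else 0) + (if p (σ f) then 1 else 0) ≤
      (if p1 f then 1 else 0) + (if p2 f then 1 else 0) := fun f => by
    have hup1 : ∀ x, Function.update id v u x = if x = v then u else x := fun x => by
      simp [Function.update_apply]
    have hup2 : ∀ x, Function.update id u v x = if x = u then v else x := fun x => by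
      simp [Function.update_apply]
    have hsw : ∀ x, Equiv.swap u v x = if x = u then v else if x = v then u else x := fun x => by
      rw [Equiv.swap_apply_def]
    simp only [hp, hp1, hp2, hσ, comap_adj, hup1, hup2, hsw]
    by_cases hv : ∃ b, f b = v
    · by_cases hu : ∃ a, f a = u
      · obtain ⟨a, ha⟩ := hu
        obtain ⟨b, hb⟩ := hv
        have hfa : ∀ x, f x = u ↔ x = a := fun x => by rw [← ha, f.injective.eq_iff]
        have hfb : ∀ x, f x = v ↔ x = b := fun x => by rw [← hb, f.injective.eq_iff]
        simp only [hfa, hfb]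
        have key : (∀ x y, H.Adj x y → G.Adj (f x) (f y)) ∨
            (∀ x y, H.Adj x y → G.Adj (if x = a then v else if x = b then u else f x)
              (if y = a then v else if y = b then u else f y)) →
            (∀ x y, H.Adj x y → G.Adj (if x = b then u else f x) (if y = b then u else f y)) ∧
            (∀ x y, H.Adj x y →
              G.Adj (if x = a then v else f x) (if y = a then v else f y)) := by
          intro h
          have hab : ¬ H.Adj a b := by
            intro hab
            rcases h with h | h
            · exact huv (by simpa [ha, hb] using h a b hab)
            · have := h a b hab
              have hba : b ≠ a := fun h => hne (by rw [← ha, ← hb, h])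
              rw [if_pos rfl, if_neg hba, if_pos rfl] at this
              exact huv this.symm
          have hab' : ¬ H.Adj b a := fun h => hab h.symm
          have htw : ∀ x, H.Adj a x ↔ H.Adj b x := fun x => by
            constructor
            · intro h; by_contra h'; exact hH.trans _ _ _ hab h' h
            · intro h; by_contra h'; exact hH.trans _ _ _ hab' h' h
          have htw' : ∀ x, H.Adj x a ↔ H.Adj x b := fun x => by
            rw [H.adj_comm x a, H.adj_comm x b, htw]
          have hba : b ≠ a := fun h => hne (by rw [← ha, ← hb, h])
          have hirr := H.loopless.irrefl
          rcases h with h | h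
          · constructor
            · intro x y hxy
              have := h x y hxy
              have h1 := h a y
              have h2 := h x a
              rw [ha] at h1 h2
              split_ifs with hx hy hy <;> grind
            · intro x y hxy
              have := h x y hxy
              have h1 := h b y
              have h2 := h x b
              rw [hb] at h1 h2
              split_ifs with hx hy hy <;> grind
          · constructor
            · intro x y hxy
              have := h x y hxy
              have h1 := h b y
              have h2 := h x b
              split_ifs with hx hy hy <;> grind
            · intro x y hxy
              have := h x y hxy
              have h1 := h a y
              have h2 := h x a
              split_ifs with hx hy hy <;> grind
        split_ifs <;> first | omega | tauto
      · push Not at hu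
        simp only [hu, if_false]
        omega
    · push Not at hv
      simp only [hv, if_false]
      exact le_rfl
  calc 2 * ∑ f, (if p f then 1 else 0)
      = ∑ f, ((if p f then 1 else 0) + (if p (σ f) then 1 else 0)) := by
        rw [Finset.sum_add_distrib, Equiv.sum_comp σ fun f => if p f then 1 else 0, two_mul]
    _ ≤ ∑ f, ((if p1 f then 1 else 0) + (if p2 f then 1 else 0)) :=
        Finset.sum_le_sum fun f _ => hpt f
    _ = _ := Finset.sum_add_distrib

/-- `G` contains no clique on `m` vertices and has as many labelled copies of `H` as possible for
such a graph on its vertex set. -/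
def IsCopyMaximal [Fintype V] [Fintype W] (m : ℕ) (H : SimpleGraph W) (G : SimpleGraph V) :
    Prop :=
  (⊤ : SimpleGraph (Fin m)).Free G ∧ ∀ G' : SimpleGraph V, (⊤ : SimpleGraph (Fin m)).Free G' →
    G'.labelledCopyCount H ≤ G.labelledCopyCount H

theorem IsCopyMaximal.cloneVertex [Fintype V] [Fintype W] {m : ℕ} {G : SimpleGraph V}
    {H : SimpleGraph W} (hG : IsCopyMaximal m H G) (hH : H.IsCompleteMultipartite) {u v : V}
    (huv : ¬ G.Adj u v) (hne : u ≠ v) : IsCopyMaximal m H (G.cloneVertex u v) := by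
  refine ⟨hG.1.comap_top _, fun G' hG' => (hG.2 G' hG').trans ?_⟩
  have h1 := two_mul_labelledCopyCount_le G hH huv hne
  have h2 := hG.2 (G.cloneVertex v u) (hG.1.comap_top _)
  omega

variable [Fintype V]

open scoped Classical in
/-- The number of ordered pairs of vertices with the same neighbourhood. -/
noncomputable def twinCount (G : SimpleGraph V) : ℕ :=
  (Finset.univ.filter fun p : V × V => ∀ z, G.Adj p.1 z ↔ G.Adj p.2 z).card

open scoped Classical in
/-- The number of vertices with the same neighbourhood as `x`. -/
noncomputable def twinClassCard (G : SimpleGraph V) (x : V) : ℕ :=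
  (Finset.univ.filter fun y : V => ∀ z, G.Adj x z ↔ G.Adj y z).card

/-- Moving a vertex from its class of twins to a class that is at least as large increases the
number of pairs of twins. -/
theorem twinCount_lt_cloneVertex {G : SimpleGraph V} {u v : V} (huv : ¬ G.Adj u v)
    (hntw : ¬ ∀ z, G.Adj u z ↔ G.Adj v z) (hle : G.twinClassCard v ≤ G.twinClassCard u) :
    G.twinCount < (G.cloneVertex u v).twinCount := by
  classical
  set R : V → V → Prop := fun x y => ∀ z, G.Adj x z ↔ G.Adj y z with hR
  set R' : V → V → Prop := fun x y => ∀ z, (G.cloneVertex u v).Adj x z ↔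
    (G.cloneVertex u v).Adj y z with hR'
  have hne : u ≠ v := by rintro rfl; exact hntw fun z => Iff.rfl
  have hsymm : ∀ {x y}, R x y → R y x := fun h z => (h z).symm
  have hsymm' : ∀ {x y}, R' x y → R' y x := fun h z => (h z).symm
  have hold : ∀ {x y}, x ≠ v → y ≠ v → R x y → R' x y := fun {x y} hx hy h z => by
    simp only [comap_adj, Function.update_of_ne hx, Function.update_of_ne hy, id]
    exact h _
  have hnv : ∀ {y}, R u y → y ≠ v := by rintro y h rfl; exact hntw h
  have hnew : ∀ {y}, R u y → R' v y := fun {y} h z => by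
    simp only [comap_adj, Function.update_self, Function.update_of_ne (hnv h), id]
    exact h _
  set A := Finset.univ.filter fun y => R u y
  set B := Finset.univ.filter fun y => R v y
  have hAB : B.card ≤ A.card := hle
  have hvA : v ∉ A := fun h => hntw (Finset.mem_filter.1 h).2
  have hvB : v ∈ B := Finset.mem_filter.2 ⟨Finset.mem_univ _, fun z => Iff.rfl⟩
  set S := Finset.univ.filter fun p : V × V => R p.1 p.2
  set S' := Finset.univ.filter fun p : V × V => R' p.1 p.2
  set S₀ := S.filter fun p => p.1 ≠ v ∧ p.2 ≠ v
  have hS : S ⊆ S₀ ∪ (B.map ⟨fun y => (v, y), Prod.mk_right_injective v⟩ ∪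
      (B.erase v).map ⟨fun y => (y, v), Prod.mk_left_injective v⟩) := by
    rintro ⟨x, y⟩ hxy
    have hxy' : R x y := (Finset.mem_filter.1 hxy).2
    simp only [Finset.mem_union, Finset.mem_map, Function.Embedding.coeFn_mk, Prod.mk.injEq]
    by_cases hx : x = v
    · subst hx
      exact Or.inr (Or.inl ⟨y, Finset.mem_filter.2 ⟨Finset.mem_univ _, hxy'⟩, rfl, rfl⟩)
    · by_cases hy : y = v
      · subst hy
        refine Or.inr (Or.inr ⟨x, Finset.mem_erase.2 ⟨hx, Finset.mem_filter.2
          ⟨Finset.mem_univ _, hsymm hxy'⟩⟩, rfl, rfl⟩)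
      · exact Or.inl (Finset.mem_filter.2 ⟨hxy, hx, hy⟩)
  have hS' : S₀ ∪ ((insert v A).map ⟨fun y => (v, y), Prod.mk_right_injective v⟩ ∪
      A.map ⟨fun y => (y, v), Prod.mk_left_injective v⟩) ⊆ S' := by
    rintro ⟨x, y⟩ hxy
    simp only [Finset.mem_union, Finset.mem_map, Function.Embedding.coeFn_mk, Prod.mk.injEq] at hxy
    refine Finset.mem_filter.2 ⟨Finset.mem_univ _, ?_⟩
    rcases hxy with h | ⟨z, hz, rfl, rfl⟩ | ⟨z, hz, rfl, rfl⟩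
    · obtain ⟨h1, h2, h3⟩ := Finset.mem_filter.1 h
      exact hold h2 h3 (Finset.mem_filter.1 h1).2
    · rcases Finset.mem_insert.1 hz with rfl | hz
      · exact fun z => Iff.rfl
      · exact hnew (Finset.mem_filter.1 hz).2
    · exact hsymm' (hnew (Finset.mem_filter.1 hz).2)
  have hd1 : Disjoint S₀ ((insert v A).map ⟨fun y => (v, y), Prod.mk_right_injective v⟩ ∪
      A.map ⟨fun y => (y, v), Prod.mk_left_injective v⟩) := by
    rw [Finset.disjoint_left]
    rintro ⟨x, y⟩ h h'
    have h0 := (Finset.mem_filter.1 h).2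
    simp only [Finset.mem_union, Finset.mem_map, Function.Embedding.coeFn_mk, Prod.mk.injEq] at h'
    rcases h' with ⟨z, -, h1, -⟩ | ⟨z, -, -, h1⟩
    · exact h0.1 h1.symm
    · exact h0.2 h1.symm
  have hd2 : Disjoint ((insert v A).map ⟨fun y => (v, y), Prod.mk_right_injective v⟩)
      (A.map ⟨fun y => (y, v), Prod.mk_left_injective v⟩) := by
    rw [Finset.disjoint_left]
    rintro ⟨x, y⟩ h h'
    simp only [Finset.mem_map, Function.Embedding.coeFn_mk, Prod.mk.injEq] at h h'
    obtain ⟨z, -, h1, -⟩ := h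
    obtain ⟨z', h2, h3, -⟩ := h'
    exact hvA (by rwa [h1, ← h3])
  have c1 := Finset.card_le_card hS
  have c2 := Finset.card_le_card hS'
  rw [Finset.card_union_of_disjoint hd1, Finset.card_union_of_disjoint hd2, Finset.card_map,
    Finset.card_map, Finset.card_insert_of_notMem hvA] at c2
  have c3 := Finset.card_union_le S₀ (B.map ⟨fun y => (v, y), Prod.mk_right_injective v⟩ ∪
      (B.erase v).map ⟨fun y => (y, v), Prod.mk_left_injective v⟩)
  have c4 := Finset.card_union_le (B.map ⟨fun y => (v, y), Prod.mk_right_injective v⟩)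
      ((B.erase v).map ⟨fun y => (y, v), Prod.mk_left_injective v⟩)
  rw [Finset.card_map, Finset.card_map, Finset.card_erase_of_mem hvB] at c4
  have e1 : G.twinCount = S.card := rfl
  have e2 : (G.cloneVertex u v).twinCount = S'.card := rfl
  omega

/-- A copy-maximal graph which is not complete multipartite can be symmetrized. -/
theorem IsCopyMaximal.exists_cloneVertex [Fintype W] {m : ℕ} {G : SimpleGraph V}
    {H : SimpleGraph W} (hG : IsCopyMaximal m H G) (hH : H.IsCompleteMultipartite)
    (hGc : ¬ G.IsCompleteMultipartite) : ∃ u v : V, u ≠ v ∧ ¬ G.Adj u v ∧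
      IsCopyMaximal m H (G.cloneVertex u v) ∧ G.twinCount < (G.cloneVertex u v).twinCount := by
  have : ∃ u v : V, ¬ G.Adj u v ∧ ¬ ∀ z, G.Adj u z ↔ G.Adj v z := by
    by_contra! h
    exact hGc ⟨fun x y z hxy hyz => by rwa [h x y hxy z]⟩
  obtain ⟨u, v, huv, hntw⟩ := this
  have hne : u ≠ v := by rintro rfl; exact hntw fun z => Iff.rfl
  rcases le_total (G.twinClassCard v) (G.twinClassCard u) with hle | hle
  · exact ⟨u, v, hne, huv, hG.cloneVertex hH huv hne, twinCount_lt_cloneVertex huv hntw hle⟩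
  · have hvu : ¬ G.Adj v u := fun h => huv h.symm
    exact ⟨v, u, hne.symm, hvu, hG.cloneVertex hH hvu hne.symm,
      twinCount_lt_cloneVertex hvu (fun h => hntw fun z => (h z).symm) hle⟩

theorem IsCompleteMultipartite.exists_eq_colorGraph {U : Type*} {r : ℕ} {G : SimpleGraph U}
    (hG : G.IsCompleteMultipartite) (hfree : (⊤ : SimpleGraph (Fin (r + 1))).Free G) :
    ∃ c : U → Fin r, G = colorGraph c := by
  obtain ⟨C⟩ := hG.colorable_of_cliqueFree (n := r + 1)
    (by simpa using cliqueFree_iff_top_free.2 hfree)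
  let q : U → Quotient hG.setoid := Quotient.mk hG.setoid
  have hq : ∀ x y, q x = q y ↔ ¬ G.Adj x y := fun x y => Quotient.eq (r := hG.setoid)
  refine ⟨fun x => C (q x).out, ?_⟩
  ext x y
  rw [comap_adj, top_adj]
  constructor
  · intro h
    refine C.valid ?_
    by_contra h'
    rw [← hq] at h'
    have h1 : q (q x).out = q x := Quotient.out_eq _
    have h2 : q (q y).out = q y := Quotient.out_eq _
    exact (hq x y).1 (by rw [← h1, ← h2, h']) h
  · intro h
    by_contra h'
    rw [← hq] at h'
    exact h (by rw [h'])

theorem exists_isCopyMaximal [Fintype W] {m : ℕ} (hm : 2 ≤ m) (H : SimpleGraph W) :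
    ∃ G : SimpleGraph V, IsCopyMaximal m H G := by
  classical
  have hbot : (⊤ : SimpleGraph (Fin m)).Free (⊥ : SimpleGraph V) := by
    have := Fin.nontrivial_iff_two_le.2 hm
    exact free_bot top_ne_bot
  obtain ⟨G, hG, hmax⟩ := Finset.exists_max_image
    (Finset.univ.filter fun G : SimpleGraph V => (⊤ : SimpleGraph (Fin m)).Free G)
    (fun G => G.labelledCopyCount H) ⟨⊥, by simpa using hbot⟩
  exact ⟨G, (Finset.mem_filter.1 hG).2, fun G' hG' => hmax G' (by simpa using hG')⟩

/-- Some copy-maximal graph is complete multipartite. -/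
theorem exists_isCopyMaximal_colorGraph [Fintype W] {r : ℕ} (hr : 1 ≤ r) {H : SimpleGraph W}
    (hH : H.IsCompleteMultipartite) :
    ∃ c : V → Fin r, IsCopyMaximal (r + 1) H (colorGraph c) := by
  classical
  obtain ⟨G₀, hG₀⟩ := exists_isCopyMaximal (V := V) (m := r + 1) (by omega) H
  obtain ⟨G, hG, hmax⟩ := Finset.exists_max_image
    (Finset.univ.filter fun G : SimpleGraph V => IsCopyMaximal (r + 1) H G)
    (fun G => G.twinCount) ⟨G₀, by simpa using hG₀⟩
  replace hG := (Finset.mem_filter.1 hG).2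
  by_cases hGc : G.IsCompleteMultipartite
  · obtain ⟨c, rfl⟩ := hGc.exists_eq_colorGraph hG.1
    exact ⟨c, hG⟩
  · obtain ⟨u, v, -, -, h, hlt⟩ := hG.exists_cloneVertex hH hGc
    exact absurd (hmax _ (by simpa using h)) (not_le.2 hlt)

theorem free_colorGraph {U : Type*} {r : ℕ} (c : U → Fin r) :
    (⊤ : SimpleGraph (Fin (r + 1))).Free (colorGraph c) := by
  rintro ⟨f⟩
  have := Fintype.card_le_of_injective (fun i => c (f i)) fun i j h => by
    by_contra hij
    exact f.toHom.map_adj (v := i) (w := j) hij h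
  simp at this

/-- If cloning one vertex of a copy-maximal graph `G` gives a complete multipartite graph, then
`G` is itself complete multipartite: the cloned vertex has no neighbour in some class, for
otherwise there is a clique; putting it into that class gives a complete multipartite graph that
contains `G` and, if it is larger, has more copies. -/
theorem IsCopyMaximal.eq_colorGraph_of_cloneVertex [Fintype W] {r : ℕ} {G : SimpleGraph V}
    {H : SimpleGraph W} (hG : IsCopyMaximal (r + 1) H G) {u v : V} {c : V → Fin r}
    (hc : G.cloneVertex u v = colorGraph c)
    (hedge : ∀ i x y, (colorGraph (Function.update c v i)).Adj x y →
      ∃ (f : Copy H (colorGraph (Function.update c v i))) (a b : W),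
        H.Adj a b ∧ f a = x ∧ f b = y) :
    ∃ c' : V → Fin r, G = colorGraph c' := by
  classical
  have hoff : ∀ {x y}, x ≠ v → y ≠ v → (G.Adj x y ↔ c x ≠ c y) := fun {x y} hx hy => by
    have : (G.cloneVertex u v).Adj x y ↔ (colorGraph c).Adj x y := by rw [hc]
    simpa [Function.update_of_ne hx, Function.update_of_ne hy] using this
  have hcol : ∃ i, ∀ w, w ≠ v → c w = i → ¬ G.Adj v w := by
    by_contra! h
    choose w hwv hcw hadj using h
    refine hG.1 ?_
    let g : (⊤ : SimpleGraph (Fin (r + 1))) →g G := ⟨Fin.cons v w, fun {a b} hab => by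
      have hab : a ≠ b := hab
      induction a using Fin.cases with
      | zero =>
        induction b using Fin.cases with
        | zero => exact absurd rfl hab
        | succ j => simpa using hadj j
      | succ i =>
        induction b using Fin.cases with
        | zero => simpa using (hadj i).symm
        | succ j =>
          simp only [Fin.cons_succ]
          rw [hoff (hwv i) (hwv j), hcw, hcw]
          exact fun h => hab (by rw [h])⟩
    exact ⟨g.toCopy g.injective_of_top_hom⟩
  obtain ⟨i, hi⟩ := hcol
  have hle : G ≤ colorGraph (Function.update c v i) := by
    intro x y hxy
    rw [comap_adj, top_adj]
    by_cases hx : x = v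
    · subst hx
      have hy : y ≠ x := hxy.ne'
      rw [Function.update_self, Function.update_of_ne hy]
      exact fun h => hi y hy h.symm hxy
    · by_cases hy : y = v
      · subst hy
        rw [Function.update_self, Function.update_of_ne hx]
        exact fun h => hi x hx h hxy.symm
      · rw [Function.update_of_ne hx, Function.update_of_ne hy]
        exact (hoff hx hy).1 hxy
  refine ⟨Function.update c v i, le_antisymm hle fun x y hxy => ?_⟩
  by_contra hnot
  obtain ⟨f, a, b, hab, rfl, rfl⟩ := hedge i x y hxy
  have hlt := labelledCopyCount_lt_of_copy hle f hab hnot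
  exact absurd (hG.2 _ (free_colorGraph _)) (not_le.2 hlt)

/-- If the complete multipartite copy-maximal graphs are robust in the sense that every edge lies
in a copy, even after a vertex has been moved to another class, then all copy-maximal graphs are
complete multipartite. -/
theorem IsCopyMaximal.exists_eq_colorGraph [Fintype W] {r : ℕ} {H : SimpleGraph W}
    (hH : H.IsCompleteMultipartite)
    (hedge : ∀ c : V → Fin r, IsCopyMaximal (r + 1) H (colorGraph c) →
      ∀ v i x y, (colorGraph (Function.update c v i)).Adj x y →
      ∃ (f : Copy H (colorGraph (Function.update c v i))) (a b : W),
        H.Adj a b ∧ f a = x ∧ f b = y)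
    {G : SimpleGraph V} (hG : IsCopyMaximal (r + 1) H G) : ∃ c : V → Fin r, G = colorGraph c := by
  classical
  by_contra hcon
  obtain ⟨G₁, hG₁, hmax⟩ := Finset.exists_max_image
    (Finset.univ.filter fun G : SimpleGraph V => IsCopyMaximal (r + 1) H G ∧
      ¬ ∃ c : V → Fin r, G = colorGraph c)
    (fun G => G.twinCount) ⟨G, by simpa using ⟨hG, by simpa using hcon⟩⟩
  obtain ⟨hM, hn⟩ := (Finset.mem_filter.1 hG₁).2
  have hGc : ¬ G₁.IsCompleteMultipartite := fun h => hn (h.exists_eq_colorGraph hM.1)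
  obtain ⟨u, v, -, -, h, hlt⟩ := hM.exists_cloneVertex hH hGc
  by_cases hc : ∃ c : V → Fin r, G₁.cloneVertex u v = colorGraph c
  · obtain ⟨c, hc⟩ := hc
    exact hn (hM.eq_colorGraph_of_cloneVertex hc (hedge c (hc ▸ h) v))
  · exact absurd (hmax _ (Finset.mem_filter.2 ⟨Finset.mem_univ _, h, hc⟩)) (not_le.2 hlt)

end Zykov

/-! ### Reduction to the optimization of part sizes -/

section Reduction

theorem multipartiteK_isCompleteMultipartite (r s t : ℕ) :
    (multipartiteK r s t).IsCompleteMultipartite :=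
  completeMultipartiteGraph.isCompleteMultipartite _

theorem copyCount_le_genEx {n : ℕ} {α β : Type*} {T : SimpleGraph α} {H : SimpleGraph β}
    {G : SimpleGraph (Fin n)} (hG : H.Free G) : G.copyCount T ≤ genEx n T H := by
  classical
  unfold genEx
  exact Finset.le_sup (f := fun G : SimpleGraph (Fin n) => G.copyCount T)
    (Finset.mem_filter.2 ⟨Finset.mem_univ _, hG⟩)

theorem isCopyMaximal_iff {n m : ℕ} {W : Type*} [Fintype W] {T : SimpleGraph W}
    {G : SimpleGraph (Fin n)} : IsCopyMaximal m T G ↔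
      (⊤ : SimpleGraph (Fin m)).Free G ∧
        G.copyCount T = genEx n T (⊤ : SimpleGraph (Fin m)) := by
  classical
  have := finite_iso T T
  have hpos : 0 < Nat.card (T ≃g T) := Nat.card_pos
  refine and_congr_right fun hG => ?_
  simp only [labelledCopyCount_eq_copyCount_mul, Nat.mul_le_mul_right_iff hpos]
  constructor
  · intro h
    refine le_antisymm (copyCount_le_genEx hG) ?_
    unfold genEx
    exact Finset.sup_le fun G' hG' => h G' (Finset.mem_filter.1 hG').2
  · intro h G' hG'
    rw [h]
    exact copyCount_le_genEx hG'

theorem exists_coloring_card {r n : ℕ} (ν : Fin r → ℕ) (hν : ∑ i, ν i = n) :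
    ∃ c : Fin n → Fin r, ∀ i, Fintype.card {x // c x = i} = ν i := by
  subst hν
  refine ⟨fun x => (finSigmaFinEquiv.symm x).1, fun i => ?_⟩
  rw [← Fintype.card_fin (ν i)]
  refine Fintype.card_congr ((finSigmaFinEquiv.symm.subtypeEquiv (q := fun a => a.1 = i)
    fun a => Iff.rfl).trans (Equiv.sigmaSubtype i))

theorem sum_card_fiber {n r : ℕ} (c : Fin n → Fin r) :
    ∑ i, Fintype.card {x // c x = i} = n := by
  rw [← Fintype.card_sigma, Fintype.card_congr (Equiv.sigmaFiberEquiv c), Fintype.card_fin]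

/-- The part sizes differ by at most one. -/
def IsBalanced {ι : Type*} (ν : ι → ℕ) : Prop := ∀ i j, ν i ≤ ν j + 1

theorem IsBalanced.div_le {n r : ℕ} {ν : Fin r → ℕ} (h : IsBalanced ν) (hn : ∑ i, ν i = n)
    (i : Fin r) : n / r ≤ ν i := by
  by_contra! hlt
  have h1 : ∑ j, ν j < ∑ _j : Fin r, n / r :=
    Finset.sum_lt_sum (fun j _ => by have := h j i; omega) ⟨i, Finset.mem_univ _, hlt⟩
  rw [hn, Finset.sum_const, Finset.card_univ, Fintype.card_fin, smul_eq_mul] at h1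
  exact absurd (Nat.mul_div_le n r) (not_le.2 h1)

/-- The part sizes of the Turán graph. -/
def turanPart (n r : ℕ) (i : Fin r) : ℕ := n / r + if (i : ℕ) < n % r then 1 else 0

/-- The residue colouring, whose colour classes are the parts of the Turán graph. -/
def turanColoring (n : ℕ) {r : ℕ} (hr : 0 < r) (x : Fin n) : Fin r := ⟨x % r, Nat.mod_lt _ hr⟩

theorem turanGraph_eq_colorGraph (n : ℕ) {r : ℕ} (hr : 0 < r) :
    turanGraph n r = colorGraph (turanColoring n hr) := by
  ext x y
  simp [turanGraph_adj, turanColoring]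

theorem card_turanColoring (n : ℕ) {r : ℕ} (hr : 0 < r) (i : Fin r) :
    Fintype.card {x // turanColoring n hr x = i} = turanPart n r i := by
  have h1 := Nat.count_modEq_card n hr (i : ℕ)
  rw [Nat.mod_eq_of_lt i.2, Nat.count_eq_card_filter_range] at h1
  rw [turanPart, ← h1, Fintype.card_subtype]
  refine Finset.card_bij (fun x _ => (x : ℕ)) ?_ ?_ ?_
  · intro x hx
    have hx' := congrArg Fin.val (Finset.mem_filter.1 hx).2
    refine Finset.mem_filter.2 ⟨Finset.mem_range.2 x.2, ?_⟩
    rw [Nat.ModEq, Nat.mod_eq_of_lt i.2]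
    exact hx'
  · intro x _ y _ h
    exact Fin.ext h
  · intro y hy
    obtain ⟨h1, h2⟩ := Finset.mem_filter.1 hy
    refine ⟨⟨y, Finset.mem_range.1 h1⟩, Finset.mem_filter.2 ⟨Finset.mem_univ _, ?_⟩, rfl⟩
    rw [Nat.ModEq, Nat.mod_eq_of_lt i.2] at h2
    exact Fin.ext h2

theorem isBalanced_turanPart (n r : ℕ) : IsBalanced (turanPart n r) := fun i j => by
  unfold turanPart
  split_ifs <;> omega

theorem sum_turanPart (n : ℕ) {r : ℕ} (hr : 0 < r) : ∑ i, turanPart n r i = n := by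
  refine Eq.trans ?_ (sum_card_fiber (turanColoring n hr))
  exact Finset.sum_congr rfl fun i _ => (card_turanColoring n hr i).symm

theorem nonempty_iso_turanGraph_of_isBalanced {n r : ℕ} (c : Fin n → Fin r)
    (hsurj : Function.Surjective c) (hb : IsBalanced fun i => Fintype.card {x // c x = i}) :
    Nonempty (colorGraph c ≃g turanGraph n r) := by
  classical
  let P := Finpartition.ofSetoid (Setoid.ker c)
  have hpart : ∀ x, P.part x = Finset.univ.filter fun y => c y = c x := fun x => by
    ext y
    rw [Finpartition.mem_part_ofSetoid_iff_rel]
    simp [eq_comm]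
  have hmem : ∀ p ∈ P.parts, ∃ i, p = Finset.univ.filter fun y => c y = i := fun p hp => by
    obtain ⟨x, hx⟩ := P.nonempty_of_mem_parts hp
    exact ⟨c x, by rw [← hpart, P.part_eq_of_mem hp hx]⟩
  have hcard : P.parts.card = r := by
    have : P.parts = Finset.univ.image fun i : Fin r => Finset.univ.filter fun y => c y = i := by
      ext p
      rw [Finset.mem_image]
      constructor
      · intro hp
        obtain ⟨i, rfl⟩ := hmem p hp
        exact ⟨i, Finset.mem_univ _, rfl⟩
      · rintro ⟨i, -, rfl⟩
        obtain ⟨x, rfl⟩ := hsurj i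
        rw [← hpart]
        exact P.part_mem.2 (Finset.mem_univ x)
    rw [this, Finset.card_image_of_injective, Finset.card_univ, Fintype.card_fin]
    intro i j hij
    obtain ⟨x, rfl⟩ := hsurj i
    have : x ∈ Finset.univ.filter fun y => c y = c x := by simp
    rw [show (Finset.univ.filter fun y => c y = c x) = Finset.univ.filter fun y => c y = j
      from hij] at this
    exact (Finset.mem_filter.1 this).2
  have heq : P.IsEquipartition := by
    rw [Finpartition.IsEquipartition, Set.equitableOn_iff_exists_le_le_add_one]
    obtain _ | n := n
    · refine ⟨0, fun p hp => ?_⟩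
      obtain ⟨x, -⟩ := P.nonempty_of_mem_parts hp
      exact x.elim0
    · obtain ⟨i₀, -, hi₀⟩ := Finset.exists_min_image Finset.univ
        (fun i => Fintype.card {x // c x = i}) ⟨c 0, Finset.mem_univ _⟩
      refine ⟨Fintype.card {x // c x = i₀}, fun p hp => ?_⟩
      obtain ⟨i, rfl⟩ := hmem p hp
      rw [← Fintype.card_subtype]
      exact ⟨hi₀ i (Finset.mem_univ _), hb i i₀⟩
  obtain ⟨zm, zp⟩ := heq.exists_partPreservingEquiv
  have hn : (Finset.univ : Finset (Fin n)).card = n := by simp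
  refine ⟨⟨((Equiv.subtypeUnivEquiv Finset.mem_univ).symm.trans zm).trans (finCongr hn), ?_⟩⟩
  intro a b
  have h := zp ⟨a, Finset.mem_univ a⟩ ⟨b, Finset.mem_univ b⟩
  rw [hcard] at h
  rw [turanGraph_adj, comap_adj, top_adj, not_iff_not]
  refine Iff.trans h.symm ?_
  change P.part a = P.part b ↔ _
  rw [hpart, hpart]
  constructor
  · intro h
    have : a ∈ Finset.univ.filter fun y => c y = c a := by simp
    rw [h] at this
    exact (Finset.mem_filter.1 this).2
  · intro h
    rw [h]

/-- If all classes of a complete multipartite graph are large, then every edge lies in a copy of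
`multipartiteK r s t`. -/
theorem exists_copy_multipartiteK {V : Type*} [Fintype V] {r s t : ℕ} (hs : 1 ≤ s) (hst : s ≤ t)
    (c : V → Fin r) (hc : ∀ i, t ≤ Fintype.card {x // c x = i}) {x y : V}
    (hxy : (colorGraph c).Adj x y) :
    ∃ (f : Copy (multipartiteK r s t) (colorGraph c)) (a b : _),
      (multipartiteK r s t).Adj a b ∧ f a = x ∧ f b = y := by
  classical
  have hxy' : c x ≠ c y := hxy
  have hex : ∀ (p : Fin r) (w : {x // c x = p}), ∃ g : Fin (if (p : ℕ) = 0 then t else s) ↪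
      {x // c x = Equiv.refl _ p}, ∃ a, (g a : V) = w := by
    intro p w
    have hne : 0 < if (p : ℕ) = 0 then t else s := by split_ifs <;> omega
    have : Fintype.card (Fin (if (p : ℕ) = 0 then t else s)) ≤ Fintype.card {x // c x = p} := by
      rw [Fintype.card_fin]
      have := hc p
      split_ifs <;> omega
    obtain ⟨e⟩ := Function.Embedding.nonempty_of_card_le this
    exact ⟨e.trans (Equiv.swap (e ⟨0, hne⟩) w).toEmbedding, ⟨0, hne⟩,
      congrArg Subtype.val (Equiv.swap_apply_left (e ⟨0, hne⟩) w)⟩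
  have hw : ∀ p : Fin r, ∃ w : {x // c x = p}, (p = c x → w = x) ∧ (p = c y → (w : V) = y) := by
    intro p
    by_cases hx : p = c x
    · exact ⟨⟨x, hx.symm⟩, fun _ => rfl, fun hy => absurd (hx.symm.trans hy) hxy'⟩
    · by_cases hy : p = c y
      · exact ⟨⟨y, hy.symm⟩, fun h => absurd h hx, fun _ => rfl⟩
      · have : 0 < Fintype.card {x // c x = p} := by have := hc p; omega
        obtain ⟨w⟩ := Fintype.card_pos_iff.1 this
        exact ⟨w, fun h => absurd h hx, fun h => absurd h hy⟩
  choose w hwx hwy using hw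
  choose g a hg using fun p => hex p (w p)
  refine ⟨copyOfPerm (Equiv.refl _) g, ⟨c x, a _⟩, ⟨c y, a _⟩, hxy', ?_, ?_⟩
  · exact (hg _).trans (hwx _ rfl)
  · exact (hg _).trans (hwy _ rfl)

/-- The factor between the number of copies of `multipartiteK (k + 1) s (s + d)` and
`partWeight s d`. -/
noncomputable def copyConst (k s d : ℕ) : ℝ :=
  k.factorial / Nat.card (multipartiteK (k + 1) s (s + d) ≃g multipartiteK (k + 1) s (s + d))

theorem copyConst_pos (k s d : ℕ) : 0 < copyConst k s d := by
  have := finite_iso (multipartiteK (k + 1) s (s + d)) (multipartiteK (k + 1) s (s + d))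
  exact div_pos (by exact_mod_cast k.factorial_pos) (by exact_mod_cast Nat.card_pos)

theorem copyCount_colorGraph {V : Type*} [Fintype V] (k s d : ℕ) (hs : 1 ≤ s)
    (c : V → Fin (k + 1)) :
    ((colorGraph c).copyCount (multipartiteK (k + 1) s (s + d)) : ℝ) =
      copyConst k s d * partWeight s d fun i => Fintype.card {x // c x = i} := by
  have h := labelledCopyCount_multipartiteK k s d hs c
  rw [labelledCopyCount_eq_copyCount_mul] at h
  have := finite_iso (multipartiteK (k + 1) s (s + d)) (multipartiteK (k + 1) s (s + d))
  have hpos : (0 : ℝ) <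
      Nat.card (multipartiteK (k + 1) s (s + d) ≃g multipartiteK (k + 1) s (s + d)) := by
    exact_mod_cast Nat.card_pos
  rw [copyConst, div_mul_eq_mul_div, eq_div_iff hpos.ne']
  exact_mod_cast h

theorem turanCount_eq (n k s d : ℕ) (hs : 1 ≤ s) : (turanCount n (k + 1) s (s + d) : ℝ) =
    copyConst k s d * partWeight s d (turanPart n (k + 1)) := by
  rw [turanCount, turanGraph_eq_colorGraph n k.succ_pos, copyCount_colorGraph k s d hs]
  simp only [card_turanColoring]

theorem partWeight_le_genEx (n k s d : ℕ) (hs : 1 ≤ s) (ν : Fin (k + 1) → ℕ)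
    (hν : ∑ i, ν i = n) : copyConst k s d * partWeight s d ν ≤
      (genEx n (multipartiteK (k + 1) s (s + d)) (⊤ : SimpleGraph (Fin (k + 1 + 1))) : ℝ) := by
  obtain ⟨c, hc⟩ := exists_coloring_card ν hν
  have h := copyCount_le_genEx (T := multipartiteK (k + 1) s (s + d)) (free_colorGraph c)
  have h' := copyCount_colorGraph k s d hs c
  simp only [hc] at h'
  rw [← h']
  exact_mod_cast h

theorem exists_genEx_eq (n k s d : ℕ) (hs : 1 ≤ s) : ∃ ν : Fin (k + 1) → ℕ, ∑ i, ν i = n ∧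
      (genEx n (multipartiteK (k + 1) s (s + d)) (⊤ : SimpleGraph (Fin (k + 1 + 1))) : ℝ) =
        copyConst k s d * partWeight s d ν := by
  obtain ⟨c, hc⟩ := exists_isCopyMaximal_colorGraph (V := Fin n) (r := k + 1) (by omega)
    (multipartiteK_isCompleteMultipartite (k + 1) s (s + d))
  refine ⟨_, sum_card_fiber c, ?_⟩
  rw [← (isCopyMaximal_iff.1 hc).2, copyCount_colorGraph k s d hs]

/-- If unbalanced part sizes of sum `n` are never optimal, then the Turán graph is the unique
extremal graph. -/
theorem isCopyMaximal_iff_nonempty_iso {n k s d : ℕ} (hs : 1 ≤ s)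
    (hn : (k + 1) * (s + d + 1) ≤ n)
    (hopt : ∀ ν : Fin (k + 1) → ℕ, ∑ i, ν i = n → 0 < partWeight s d ν → ¬ IsBalanced ν →
      ∃ ν' : Fin (k + 1) → ℕ, ∑ i, ν' i = n ∧ partWeight s d ν < partWeight s d ν')
    (G : SimpleGraph (Fin n)) :
    IsCopyMaximal (k + 1 + 1) (multipartiteK (k + 1) s (s + d)) G ↔
      Nonempty (G ≃g turanGraph n (k + 1)) := by
  have hdiv : s + d + 1 ≤ n / (k + 1) := (Nat.le_div_iff_mul_le k.succ_pos).2 (by linarith)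
  have hC := copyConst_pos k s d
  have hturan : 0 < partWeight s d (turanPart n (k + 1)) := by
    have hle : ∀ i, s + d ≤ turanPart n (k + 1) i := fun i =>
      le_trans (by omega) ((isBalanced_turanPart n (k + 1)).div_le (sum_turanPart n k.succ_pos) i)
    refine Nat.mul_pos (Finset.prod_pos fun i _ => Nat.descFactorial_pos.2 ?_)
      (Finset.sum_pos (fun i _ => Nat.descFactorial_pos.2 ?_) Finset.univ_nonempty)
    · have := hle i; omega
    · have := hle i; omega
  have hbal : ∀ c : Fin n → Fin (k + 1),
      IsCopyMaximal (k + 1 + 1) (multipartiteK (k + 1) s (s + d)) (colorGraph c) →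
      IsBalanced fun i => Fintype.card {x // c x = i} := by
    intro c hc
    have hmax : ∀ ν : Fin (k + 1) → ℕ, ∑ i, ν i = n → partWeight s d ν ≤
        partWeight s d fun i => Fintype.card {x // c x = i} := by
      intro ν hν
      have h1 := partWeight_le_genEx n k s d hs ν hν
      rw [← (isCopyMaximal_iff.1 hc).2, copyCount_colorGraph k s d hs] at h1
      exact_mod_cast le_of_mul_le_mul_left h1 hC
    by_contra hnb
    obtain ⟨ν', hν', hlt⟩ := hopt _ (sum_card_fiber c)
      (hturan.trans_le (hmax _ (sum_turanPart n k.succ_pos))) hnb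
    exact absurd (hmax ν' hν') (not_le.2 hlt)
  have hfib : ∀ c : Fin n → Fin (k + 1),
      IsCopyMaximal (k + 1 + 1) (multipartiteK (k + 1) s (s + d)) (colorGraph c) →
      ∀ i, s + d + 1 ≤ Fintype.card {x // c x = i} := fun c hc i =>
    hdiv.trans ((hbal c hc).div_le (sum_card_fiber c) i)
  have hforward : ∀ G : SimpleGraph (Fin n),
      IsCopyMaximal (k + 1 + 1) (multipartiteK (k + 1) s (s + d)) G →
      Nonempty (G ≃g turanGraph n (k + 1)) := by
    intro G hG
    obtain ⟨c, rfl⟩ := hG.exists_eq_colorGraph (multipartiteK_isCompleteMultipartite _ _ _) (by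
      intro c hc v i x y hxy
      refine exists_copy_multipartiteK hs (Nat.le_add_right s d) _ (fun j => ?_) hxy
      have h1 := hfib c hc j
      have h2 : (Finset.univ.filter fun x => c x = j).erase v ⊆
          Finset.univ.filter fun x => Function.update c v i x = j := by
        intro z hz
        obtain ⟨hzv, hz⟩ := Finset.mem_erase.1 hz
        refine Finset.mem_filter.2 ⟨Finset.mem_univ _, ?_⟩
        rw [Function.update_of_ne hzv]
        exact (Finset.mem_filter.1 hz).2
      have h3 := Finset.card_le_card h2
      have h4 := Finset.pred_card_le_card_erase (s := Finset.univ.filter fun x => c x = j) (a := v)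
      rw [Fintype.card_subtype] at h1 ⊢
      omega)
    refine nonempty_iso_turanGraph_of_isBalanced c (fun i => ?_) (hbal c hG)
    have : 0 < Fintype.card {x // c x = i} := by have := hfib c hG i; omega
    obtain ⟨x, hx⟩ := Fintype.card_pos_iff.1 this
    exact ⟨x, hx⟩
  refine ⟨hforward G, ?_⟩
  rintro ⟨e⟩
  obtain ⟨c, hc⟩ := exists_isCopyMaximal_colorGraph (V := Fin n) (r := k + 1) (by omega)
    (multipartiteK_isCompleteMultipartite (k + 1) s (s + d))
  obtain ⟨e'⟩ := hforward _ hc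
  rw [isCopyMaximal_iff] at hc ⊢
  have e'' : G ≃g colorGraph c := e'.symm.comp e
  exact ⟨(free_congr_right e'').2 hc.1, (copyCount_congr_iso e'' _).trans hc.2⟩

end Reduction

/-! ### Moving one vertex between two parts -/

section Exchange

variable {ι : Type*} [Fintype ι] [DecidableEq ι]

theorem sum_update_update {M : Type*} [AddCommMonoid M] (g : ℕ → M) (ν : ι → ℕ) {i j : ι}
    (hij : i ≠ j) (x y : ℕ) :
    ∑ l, g (Function.update (Function.update ν i x) j y l) =
      g x + g y + ∑ l ∈ (Finset.univ.erase i).erase j, g (ν l) := by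
  rw [← Finset.add_sum_erase _ _ (Finset.mem_univ i),
    ← Finset.add_sum_erase _ _ (Finset.mem_erase.2 ⟨hij.symm, Finset.mem_univ j⟩),
    Function.update_of_ne hij, Function.update_self, Function.update_self, ← add_assoc]
  congr 1
  refine Finset.sum_congr rfl fun l hl => ?_
  obtain ⟨h1, h2⟩ := Finset.mem_erase.1 hl
  rw [Function.update_of_ne h1, Function.update_of_ne (Finset.mem_erase.1 h2).1]

theorem prod_update_update {M : Type*} [CommMonoid M] (g : ℕ → M) (ν : ι → ℕ) {i j : ι}
    (hij : i ≠ j) (x y : ℕ) :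
    ∏ l, g (Function.update (Function.update ν i x) j y l) =
      g x * g y * ∏ l ∈ (Finset.univ.erase i).erase j, g (ν l) :=
  sum_update_update (M := Additive M) g ν hij x y

theorem sum_update_update_eq {ν : ι → ℕ} {i j : ι} (hij : i ≠ j) {x y : ℕ}
    (h : x + y = ν i + ν j) :
    ∑ l, Function.update (Function.update ν i x) j y l = ∑ l, ν l := by
  have h1 := sum_update_update (fun m => m) ν hij x y
  have h2 := sum_update_update (fun m => m) ν hij (ν i) (ν j)
  simp only [Function.update_eq_self] at h1 h2
  rw [h1, h2, h]

/-- The forward difference of the falling factorial. -/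
theorem succ_descFactorial_eq (z d : ℕ) :
    (z + 1).descFactorial d = z.descFactorial d + d * z.descFactorial (d - 1) := by
  cases d with
  | zero => simp
  | succ e =>
    rw [Nat.succ_descFactorial_succ, Nat.descFactorial_succ, Nat.add_sub_cancel]
    rcases le_or_gt e z with h | h
    · obtain ⟨w, rfl⟩ := Nat.exists_eq_add_of_le h
      rw [Nat.add_sub_cancel_left]
      ring
    · rw [Nat.descFactorial_eq_zero_iff_lt.2 h]
      ring

/-- The contribution of two parts of sizes `x` and `y` to `partWeight s d`, where `w` is the
contribution of the other parts to the second factor. -/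
def pairWeight (s d w x y : ℕ) : ℕ :=
  x.descFactorial s * y.descFactorial s *
    ((x - s).descFactorial d + (y - s).descFactorial d + w)

theorem partWeight_update_update (s d : ℕ) (ν : ι → ℕ) {i j : ι} (hij : i ≠ j) (x y : ℕ) :
    partWeight s d (Function.update (Function.update ν i x) j y) =
      pairWeight s d (∑ l ∈ (Finset.univ.erase i).erase j, (ν l - s).descFactorial d) x y *
        ∏ l ∈ (Finset.univ.erase i).erase j, (ν l).descFactorial s := by
  rw [partWeight, prod_update_update (fun m => m.descFactorial s) ν hij,
    sum_update_update (fun m => (m - s).descFactorial d) ν hij, pairWeight]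
  ring

theorem partWeight_lt_update_update {s d : ℕ} {ν : ι → ℕ} {i j : ι} (hij : i ≠ j) {x y : ℕ}
    (hpos : 0 < partWeight s d ν)
    (h : pairWeight s d (∑ l ∈ (Finset.univ.erase i).erase j, (ν l - s).descFactorial d)
        (ν i) (ν j) <
      pairWeight s d (∑ l ∈ (Finset.univ.erase i).erase j, (ν l - s).descFactorial d) x y) :
    partWeight s d ν < partWeight s d (Function.update (Function.update ν i x) j y) := by
  have h0 := partWeight_update_update s d ν hij (ν i) (ν j)
  simp only [Function.update_eq_self] at h0
  rw [partWeight_update_update s d ν hij, h0]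
  rw [h0] at hpos
  exact Nat.mul_lt_mul_of_pos_right h (Nat.pos_of_mul_pos_left hpos)

/-- The weights before and after moving one vertex from a part of size `b + s + D + 1` to a part
of size `b + s`, with the common factor `q` taken out. -/
theorem exists_pairWeight_eq {s : ℕ} (hs : 1 ≤ s) (d w b D : ℕ) : ∃ q, 0 < q ∧
    pairWeight s d w (b + s + D + 1) (b + s) = q * ((b + s + D + 1) * (b + 1) *
      ((b + D + 1).descFactorial d + b.descFactorial d + w)) ∧
    pairWeight s d w (b + s + D) (b + s + 1) = q * ((b + D + 1) * (b + s + 1) *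
      ((b + D).descFactorial d + (b + 1).descFactorial d + w)) := by
  obtain ⟨σ, rfl⟩ := Nat.exists_eq_add_of_le' hs
  refine ⟨(b + (σ + 1) + D).descFactorial σ * (b + (σ + 1)).descFactorial σ,
    Nat.mul_pos (Nat.descFactorial_pos.2 (by omega)) (Nat.descFactorial_pos.2 (by omega)), ?_, ?_⟩
  · rw [pairWeight, Nat.succ_descFactorial_succ, Nat.descFactorial_succ,
      show b + (σ + 1) - σ = b + 1 by omega,
      show b + (σ + 1) + D + 1 - (σ + 1) = b + D + 1 by omega, Nat.add_sub_cancel]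
    ring
  · rw [pairWeight, Nat.succ_descFactorial_succ, Nat.descFactorial_succ,
      show b + (σ + 1) + D - σ = b + D + 1 by omega,
      show b + (σ + 1) + D - (σ + 1) = b + D by omega,
      show b + (σ + 1) + 1 - (σ + 1) = b + 1 by omega]
    ring

/-- The products in `exists_pairWeight_eq` satisfy
`(b + D + 1) * (b + s + 1) = (b + s + D + 1) * (b + 1) + s * D`, so the gain in the first factor
is measured by `s * D` and the loss in the second one by a difference of falling factorials. The
contribution `w` of the other parts only helps. -/
theorem pairWeight_lt_inward {s : ℕ} (hs : 1 ≤ s) {d w b D : ℕ}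
    (h : (b + D + 1) * (b + s + 1) * (d * (b + D).descFactorial (d - 1)) <
      (b + D + 1) * (b + s + 1) * (d * b.descFactorial (d - 1)) +
        s * D * ((b + D + 1).descFactorial d + b.descFactorial d)) :
    pairWeight s d w (b + s + D + 1) (b + s) < pairWeight s d w (b + s + D) (b + s + 1) := by
  obtain ⟨q, hq, h1, h2⟩ := exists_pairWeight_eq hs d w b D
  rw [h1, h2]
  refine Nat.mul_lt_mul_of_pos_left ?_ hq
  rw [succ_descFactorial_eq (b + D) d] at h ⊢
  rw [succ_descFactorial_eq b d]
  generalize (b + D).descFactorial d = X at *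
  generalize b.descFactorial d = Y at *
  generalize d * (b + D).descFactorial (d - 1) = X' at *
  generalize d * b.descFactorial (d - 1) = Y' at *
  zify at h ⊢
  have hw : (0 : ℤ) ≤ s * D * w := by positivity
  linear_combination h + hw

/-- The reverse comparison; here the contribution `w` of the other parts enters the hypothesis. -/
theorem pairWeight_lt_outward {s : ℕ} (hs : 1 ≤ s) {d w b D : ℕ}
    (h : (b + s + D + 1) * (b + 1) * (d * b.descFactorial (d - 1)) +
        s * D * ((b + D).descFactorial d + (b + 1).descFactorial d + w) <
      (b + s + D + 1) * (b + 1) * (d * (b + D).descFactorial (d - 1))) :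
    pairWeight s d w (b + s + D) (b + s + 1) < pairWeight s d w (b + s + D + 1) (b + s) := by
  obtain ⟨q, hq, h1, h2⟩ := exists_pairWeight_eq hs d w b D
  rw [h1, h2]
  refine Nat.mul_lt_mul_of_pos_left ?_ hq
  rw [succ_descFactorial_eq b d] at h ⊢
  rw [succ_descFactorial_eq (b + D) d]
  generalize (b + D).descFactorial d = X at *
  generalize b.descFactorial d = Y at *
  generalize d * (b + D).descFactorial (d - 1) = X' at *
  generalize d * b.descFactorial (d - 1) = Y' at *
  zify at h ⊢
  linear_combination h

theorem two_mul_choose_two (d : ℕ) : 2 * d.choose 2 = d * (d - 1) := by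
  rw [Nat.choose_two_right, Nat.mul_div_cancel' (Nat.even_mul_pred_self d).two_dvd]

/-! ### Unbalancing a balanced partition -/

/-- If `r * s < d * (d - 1)`, then enlarging a part of maximal size at the expense of any other
part increases the weight of a balanced partition. -/
theorem exists_partWeight_lt_of_isBalanced {r s d : ℕ} (hr : 2 ≤ r) (hs : 1 ≤ s)
    (hd : r * s < 2 * d.choose 2) {ν : Fin r → ℕ} (hb : IsBalanced ν)
    (hpos : 0 < partWeight s d ν) :
    ∃ ν' : Fin r → ℕ, ∑ i, ν' i = ∑ i, ν i ∧ partWeight s d ν < partWeight s d ν' := by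
  rw [two_mul_choose_two] at hd
  obtain ⟨e, rfl⟩ : ∃ e, d = e + 2 := by
    obtain _ | _ | e := d
    · simp at hd
    · simp at hd
    · exact ⟨e, rfl⟩
  rw [show e + 2 - 1 = e + 1 by omega] at hd
  obtain ⟨i, -, hi⟩ := Finset.exists_max_image Finset.univ ν ⟨⟨0, by omega⟩, Finset.mem_univ _⟩
  have hnt : Nontrivial (Fin r) := Fin.nontrivial_iff_two_le.2 hr
  obtain ⟨j, hji⟩ := exists_ne i
  have hdeg : s + (e + 2) ≤ ν i := by
    have h2 : 0 < ∑ l, (ν l - s).descFactorial (e + 2) := Nat.pos_of_mul_pos_left hpos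
    obtain ⟨l, -, hl⟩ := Finset.exists_ne_zero_of_sum_ne_zero h2.ne'
    have := Nat.descFactorial_pos.1 (Nat.pos_of_ne_zero hl)
    have := hi l (Finset.mem_univ _)
    omega
  have hij1 := hi j (Finset.mem_univ _)
  have hij2 := hb i j
  obtain ⟨b, hbj⟩ : ∃ b, ν j = b + s + 1 := ⟨ν j - s - 1, by omega⟩
  obtain ⟨D, hD⟩ : ∃ D, ν i = b + s + D := ⟨ν i - (b + s), by omega⟩
  have hne : i ≠ j := hji.symm
  refine ⟨Function.update (Function.update ν i (b + s + D + 1)) j (b + s),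
    sum_update_update_eq hne (by omega), partWeight_lt_update_update hne hpos ?_⟩
  rw [hbj, hD]
  refine pairWeight_lt_outward hs ?_
  have hsum : (b + D).descFactorial (e + 2) + (b + 1).descFactorial (e + 2) +
      ∑ l ∈ (Finset.univ.erase i).erase j, (ν l - s).descFactorial (e + 2) ≤
      r * (b + D).descFactorial (e + 2) := by
    have h1 := sum_update_update (fun m => (m - s).descFactorial (e + 2)) ν hne (ν i) (ν j)
    simp only [Function.update_eq_self] at h1
    rw [hbj, hD, show b + s + D - s = b + D by omega, show b + s + 1 - s = b + 1 by omega] at h1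
    rw [← h1]
    refine (Finset.sum_le_card_nsmul _ _ ((b + D).descFactorial (e + 2)) fun l _ => ?_).trans_eq
      (by simp)
    have := hi l (Finset.mem_univ _)
    exact Nat.descFactorial_le _ (by omega)
  refine lt_of_le_of_lt (Nat.add_le_add_left (Nat.mul_le_mul_left (s * D) hsum) _) ?_
  rw [show e + 2 - 1 = e + 1 by omega]
  have hφ : 0 < b.descFactorial e := Nat.descFactorial_pos.2 (by omega)
  obtain rfl | rfl : D = 1 ∨ D = 2 := by omega
  -- `D = 1` if the two parts are equal, and `D = 2` if they differ by one
  · have h1 : (b + 1).descFactorial (e + 1) = b.descFactorial (e + 1) +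
        (e + 1) * b.descFactorial e := succ_descFactorial_eq b (e + 1)
    have h2 : (b + 1).descFactorial (e + 2) ≤ (b + 1) * ((b + 1) * b.descFactorial e) := by
      rw [Nat.descFactorial_succ, Nat.succ_descFactorial_succ]
      exact Nat.mul_le_mul_right _ (by omega)
    have h3 := Nat.mul_le_mul_left (r * s) h2
    calc (b + s + 1 + 1) * (b + 1) * ((e + 2) * b.descFactorial (e + 1)) +
          s * 1 * (r * (b + 1).descFactorial (e + 2))
        ≤ (b + s + 1 + 1) * (b + 1) * ((e + 2) * b.descFactorial (e + 1)) +
          (b + 1) * (b + 1) * b.descFactorial e * (r * s) := by linarith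
      _ < (b + s + 1 + 1) * (b + 1) * ((e + 2) * b.descFactorial (e + 1)) +
          (b + 1) * (b + 1) * b.descFactorial e * ((e + 2) * (e + 1)) := by gcongr
      _ ≤ (b + s + 1 + 1) * (b + 1) * ((e + 2) * b.descFactorial (e + 1)) +
          (b + s + 1 + 1) * (b + 1) * b.descFactorial e * ((e + 2) * (e + 1)) := by
        gcongr; omega
      _ = _ := by rw [h1]; ring
  · have h1 : (b + 2).descFactorial (e + 1) = (b + 1).descFactorial (e + 1) +
        (e + 1) * (b + 1).descFactorial e := succ_descFactorial_eq (b + 1) (e + 1)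
    have h1' : (b + 1).descFactorial (e + 1) = b.descFactorial (e + 1) +
        (e + 1) * b.descFactorial e := succ_descFactorial_eq b (e + 1)
    have h2 : (b + 2).descFactorial (e + 2) = (b + 2) * ((b + 1) * b.descFactorial e) := by
      rw [Nat.succ_descFactorial_succ, Nat.succ_descFactorial_succ]
    have h3 : b.descFactorial e ≤ (b + 1).descFactorial e := by
      rw [succ_descFactorial_eq b e]; omega
    calc (b + s + 2 + 1) * (b + 1) * ((e + 2) * b.descFactorial (e + 1)) +
          s * 2 * (r * (b + 2).descFactorial (e + 2))
        = (b + s + 2 + 1) * (b + 1) * ((e + 2) * b.descFactorial (e + 1)) +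
          2 * ((b + 2) * (b + 1) * b.descFactorial e) * (r * s) := by rw [h2]; ring
      _ < (b + s + 2 + 1) * (b + 1) * ((e + 2) * b.descFactorial (e + 1)) +
          2 * ((b + 2) * (b + 1) * b.descFactorial e) * ((e + 2) * (e + 1)) := by gcongr
      _ ≤ (b + s + 2 + 1) * (b + 1) * ((e + 2) * b.descFactorial (e + 1)) +
          (b + s + 2 + 1) * (b + 1) * (b.descFactorial e + (b + 1).descFactorial e) *
            ((e + 2) * (e + 1)) := by
        rw [show 2 * ((b + 2) * (b + 1) * b.descFactorial e) =
          (b + 2) * (b + 1) * (b.descFactorial e + b.descFactorial e) by ring]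
        exact Nat.add_le_add_left (Nat.mul_le_mul_right _ (Nat.mul_le_mul (Nat.mul_le_mul_right _ (by omega))
          (Nat.add_le_add_left h3 _))) _
      _ = _ := by rw [h1, h1']; ring

/-! ### Balancing an unbalanced partition -/

theorem pow_add_mul_pow_le (z m : ℕ) : z ^ (m + 1) + (m + 1) * z ^ m ≤ (z + 1) ^ (m + 1) := by
  induction m with
  | zero => simp
  | succ m ih =>
    calc z ^ (m + 1 + 1) + (m + 1 + 1) * z ^ (m + 1)
        ≤ (z + 1) * (z ^ (m + 1) + (m + 1) * z ^ m) := by ring_nf; omega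
      _ ≤ (z + 1) * (z + 1) ^ (m + 1) := Nat.mul_le_mul_left _ ih
      _ = _ := by ring

/-- Increments of falling factorials are dominated by increments of powers. -/
theorem descFactorial_add_pow_le (b D m : ℕ) :
    (b + D).descFactorial (m + 1) + b ^ (m + 1) ≤
      b.descFactorial (m + 1) + (b + D) ^ (m + 1) := by
  induction D with
  | zero => simp
  | succ D ih =>
    have h1 : (b + D + 1).descFactorial (m + 1) = (b + D).descFactorial (m + 1) +
      (m + 1) * (b + D).descFactorial m := succ_descFactorial_eq (b + D) (m + 1)
    have h2 := Nat.mul_le_mul_left (m + 1) (Nat.descFactorial_le_pow (b + D) m)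
    have h3 := pow_add_mul_pow_le (b + D) m
    rw [← add_assoc]
    omega

/-- The real counterpart of the exchange inequality. Dividing by `X - Y` turns it into a
comparison of the monomials `X ^ i * Y ^ (m + 2 - i)` with `0 < i < m + 2` with the two extreme
ones. -/
theorem two_mul_mul_pow_sub_le {X Y : ℝ} (hY : 0 ≤ Y) (hXY : Y ≤ X) (m : ℕ) :
    2 * (X * Y) * (X ^ (m + 1) - Y ^ (m + 1)) ≤
      (m + 1) * (X - Y) * (X ^ (m + 2) + Y ^ (m + 2)) := by
  have hX : 0 ≤ X := hY.trans hXY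
  have hD : 0 ≤ X - Y := sub_nonneg.2 hXY
  induction m with
  | zero =>
    simp only [Nat.cast_zero, zero_add, pow_one]
    linear_combination mul_nonneg hD (sq_nonneg (X - Y))
  | succ m ih =>
    have hcheb : 0 ≤ (X - Y) * (X ^ (m + 2) - Y ^ (m + 2)) :=
      mul_nonneg hD (sub_nonneg.2 (pow_le_pow_left₀ hY hXY _))
    have h1 := mul_le_mul_of_nonneg_left ih (add_nonneg hX hY)
    have h2 := mul_nonneg hD hcheb
    have h3 := mul_nonneg (by positivity : (0 : ℝ) ≤ m + 1) h2
    push_cast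
    have e1 : X ^ (m + 1 + 1) = X * X ^ (m + 1) := by ring
    have e2 : Y ^ (m + 1 + 1) = Y * Y ^ (m + 1) := by ring
    have e3 : X ^ (m + 2) = X * X ^ (m + 1) := by ring
    have e4 : Y ^ (m + 2) = Y * Y ^ (m + 1) := by ring
    have e5 : X ^ (m + 1 + 2) = X ^ 2 * X ^ (m + 1) := by ring
    have e6 : Y ^ (m + 1 + 2) = Y ^ 2 * Y ^ (m + 1) := by ring
    rw [e1, e2, e5, e6]
    rw [e3, e4] at h1 h2 h3
    generalize X ^ (m + 1) = p at *
    generalize Y ^ (m + 1) = q at *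
    linear_combination h1 / 2 + h2 + h3 / 2

/-- For `d.choose 2 < s`, moving a vertex from the larger to the smaller of two parts increases the
weight as soon as the smaller part is large. -/
theorem exists_inward_of_large {s d : ℕ} (hs : 1 ≤ s) (hd : d.choose 2 < s) :
    ∃ B, ∀ b D, B ≤ b → 1 ≤ D →
      (b + D + 1) * (b + s + 1) * (d * (b + D).descFactorial (d - 1)) <
      (b + D + 1) * (b + s + 1) * (d * b.descFactorial (d - 1)) +
        s * D * ((b + D + 1).descFactorial d + b.descFactorial d) := by
  obtain rfl | rfl | ⟨e, rfl⟩ : d = 0 ∨ d = 1 ∨ ∃ e, d = e + 2 := by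
    obtain _ | _ | e := d
    · simp
    · simp
    · exact Or.inr (Or.inr ⟨e, rfl⟩)
  · refine ⟨0, fun b D _ hD => ?_⟩
    simp only [Nat.descFactorial_zero]
    have : 0 < s * D := Nat.mul_pos hs hD
    omega
  · refine ⟨0, fun b D _ hD => ?_⟩
    simp only [Nat.descFactorial_one, Nat.sub_self, Nat.descFactorial_zero]
    have : 0 < s * D := Nat.mul_pos hs hD
    have : 0 < s * D * (b + D + 1 + b) := Nat.mul_pos this (by omega)
    omega
  have hlim : Tendsto (fun b : ℕ => (s : ℝ) * (1 - (e + 2 : ℝ) / b) ^ (e + 2) -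
      ((e + 2).choose 2 : ℝ) * ((1 + 1 / (b : ℝ)) * (1 + (s + 1 : ℝ) / b))) atTop
      (nhds ((s : ℝ) * (1 - 0) ^ (e + 2) -
        ((e + 2).choose 2 : ℝ) * ((1 + 0) * (1 + 0)))) := by
    have h := fun c : ℝ => tendsto_const_div_atTop_nhds_zero_nat c
    exact ((((h _).const_sub 1).pow _).const_mul _).sub
      ((((h _).const_add 1).mul ((h _).const_add 1)).const_mul _)
  have hpos : (0 : ℝ) < (s : ℝ) * (1 - 0) ^ (e + 2) -
      ((e + 2).choose 2 : ℝ) * ((1 + 0) * (1 + 0)) := by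
    have : (((e + 2).choose 2 : ℕ) : ℝ) < s := by exact_mod_cast hd
    simpa using this
  obtain ⟨B, hB⟩ := eventually_atTop.1 (hlim.eventually (lt_mem_nhds hpos))
  refine ⟨B + (e + 2), fun b D hb hD => ?_⟩
  have hBb := hB b (by omega)
  have hb0 : (0 : ℝ) < b := by exact_mod_cast (by omega : 0 < b)
  have hbe : (e + 2 : ℝ) ≤ b := by exact_mod_cast (by omega : e + 2 ≤ b)
  have hD0 : (1 : ℝ) ≤ D := by exact_mod_cast hD
  set X : ℝ := b + D with hX
  have hXb : (b : ℝ) ≤ X := by linarith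
  have hXpos : 0 < X := by linarith
  set θ : ℝ := 1 - (e + 2 : ℝ) / b with hθ
  have hθ0 : 0 ≤ θ := by rw [hθ, sub_nonneg, div_le_one hb0]; exact hbe
  -- the falling factorials on the right-hand side, from below
  have hlow : ∀ z : ℕ, b ≤ z → (θ * z) ^ (e + 2) ≤ (z.descFactorial (e + 2) : ℝ) := by
    intro z hz
    have h1 : (((z + 1 - (e + 2)) ^ (e + 2) : ℕ) : ℝ) ≤ z.descFactorial (e + 2) := by
      exact_mod_cast Nat.pow_sub_le_descFactorial z (e + 2)
    refine le_trans ?_ h1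
    rw [show z + 1 - (e + 2) = z - (e + 1) by omega]
    push_cast [Nat.cast_sub (show e + 1 ≤ z by omega)]
    refine pow_le_pow_left₀ (by positivity) ?_ _
    have hz' : (b : ℝ) ≤ z := by exact_mod_cast hz
    have h2 : (e + 2 : ℝ) ≤ (e + 2 : ℝ) / b * z := by
      rw [div_mul_eq_mul_div, le_div_iff₀ hb0]
      gcongr
    rw [hθ, sub_mul]
    linarith
  have hφ1 : θ ^ (e + 2) * X ^ (e + 2) ≤ ((b + D + 1).descFactorial (e + 2) : ℝ) := by
    rw [← mul_pow]
    refine le_trans ?_ ((hlow (b + D) (by omega)).trans ?_)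
    · push_cast; rfl
    · rw [succ_descFactorial_eq (b + D)]
      push_cast
      have : (0 : ℝ) ≤ (e + 2) * (b + D).descFactorial (e + 1) := by positivity
      simpa using this
  have hφ2 : θ ^ (e + 2) * (b : ℝ) ^ (e + 2) ≤ (b.descFactorial (e + 2) : ℝ) := by
    rw [← mul_pow]
    exact hlow b le_rfl
  -- their differences on the left-hand side, from above
  have hdiff : ((b + D).descFactorial (e + 1) : ℝ) - b.descFactorial (e + 1) ≤
      X ^ (e + 1) - (b : ℝ) ^ (e + 1) := by
    have : (((b + D).descFactorial (e + 1) + b ^ (e + 1) : ℕ) : ℝ) ≤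
        ((b.descFactorial (e + 1) + (b + D) ^ (e + 1) : ℕ) : ℝ) := by
      exact_mod_cast descFactorial_add_pow_le b D e
    push_cast at this
    rw [hX]
    linarith
  have hmean := two_mul_mul_pow_sub_le hb0.le hXb e
  have hXD : X - b = D := by rw [hX]; ring
  rw [hXD] at hmean
  have hchoose : (((e + 2).choose 2 : ℕ) : ℝ) = (e + 2) * (e + 1) / 2 := by
    rw [Nat.cast_choose_two]; push_cast; ring
  have hfac : (X + 1) * (b + s + 1) ≤
      (1 + 1 / (b : ℝ)) * (1 + (s + 1 : ℝ) / b) * (X * b) := by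
    have h1 : X + 1 ≤ (1 + 1 / (b : ℝ)) * X := by
      have : 1 ≤ 1 / (b : ℝ) * X := by rw [div_mul_eq_mul_div, one_mul, le_div_iff₀ hb0]; linarith
      linarith
    have h2 : (b : ℝ) + s + 1 = (1 + (s + 1 : ℝ) / b) * b := by field_simp; ring
    calc (X + 1) * (b + s + 1) ≤ (1 + 1 / (b : ℝ)) * X * (b + s + 1) := by gcongr
      _ = _ := by rw [h2]; ring
  have hS : 0 < X ^ (e + 2) + (b : ℝ) ^ (e + 2) := by positivity
  have hpowdiff : 0 ≤ X ^ (e + 1) - (b : ℝ) ^ (e + 1) :=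
    sub_nonneg.2 (pow_le_pow_left₀ hb0.le hXb _)
  have key : (X + 1) * (b + s + 1) * ((e + 2) *
      (((b + D).descFactorial (e + 1) : ℝ) - b.descFactorial (e + 1))) <
      s * D * (((b + D + 1).descFactorial (e + 2) : ℝ) + b.descFactorial (e + 2)) := by
    calc (X + 1) * (b + s + 1) * ((e + 2) *
          (((b + D).descFactorial (e + 1) : ℝ) - b.descFactorial (e + 1)))
        ≤ (X + 1) * (b + s + 1) * ((e + 2) * (X ^ (e + 1) - (b : ℝ) ^ (e + 1))) := by gcongr
      _ ≤ (1 + 1 / (b : ℝ)) * (1 + (s + 1 : ℝ) / b) * (X * b) *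
          ((e + 2) * (X ^ (e + 1) - (b : ℝ) ^ (e + 1))) := by gcongr
      _ = (1 + 1 / (b : ℝ)) * (1 + (s + 1 : ℝ) / b) * ((e + 2) / 2) *
          (2 * (X * b) * (X ^ (e + 1) - (b : ℝ) ^ (e + 1))) := by ring
      _ ≤ (1 + 1 / (b : ℝ)) * (1 + (s + 1 : ℝ) / b) * ((e + 2) / 2) *
          ((e + 1) * D * (X ^ (e + 2) + (b : ℝ) ^ (e + 2))) := by gcongr
      _ = ((e + 2).choose 2 : ℝ) * ((1 + 1 / (b : ℝ)) * (1 + (s + 1 : ℝ) / b)) *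
          (D * (X ^ (e + 2) + (b : ℝ) ^ (e + 2))) := by rw [hchoose]; ring
      _ < s * θ ^ (e + 2) * (D * (X ^ (e + 2) + (b : ℝ) ^ (e + 2))) := by
        refine mul_lt_mul_of_pos_right (by linarith) (by positivity)
      _ = s * D * (θ ^ (e + 2) * X ^ (e + 2) + θ ^ (e + 2) * (b : ℝ) ^ (e + 2)) := by ring
      _ ≤ _ := by gcongr
  rw [show e + 2 - 1 = e + 1 by omega]
  rify
  rw [hX] at key
  linear_combination key

/-- For `d.choose 2 < s` and large `n`, the weight of every unbalanced partition can be increased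
by moving a vertex from a largest part to a smallest one. -/
theorem eventually_exists_partWeight_lt (r : ℕ) {s d : ℕ} (hs : 1 ≤ s) (hd : d.choose 2 < s) :
    ∀ᶠ n : ℕ in atTop, ∀ ν : Fin r → ℕ, ∑ i, ν i = n → 0 < partWeight s d ν →
      ¬ IsBalanced ν → ∃ ν' : Fin r → ℕ, ∑ i, ν' i = n ∧ partWeight s d ν < partWeight s d ν' := by
  obtain ⟨B, hB⟩ := exists_inward_of_large hs hd
  set D₀ := d * (B + s + 1) + d + 1 with hD₀
  filter_upwards [eventually_ge_atTop (r * (B + s + D₀ + 1))] with n hn ν hν hpos hnb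
  simp only [IsBalanced, not_forall, not_le] at hnb
  obtain ⟨i₀, j₀, hij₀⟩ := hnb
  obtain ⟨i, -, hi⟩ := Finset.exists_max_image Finset.univ ν ⟨i₀, Finset.mem_univ _⟩
  obtain ⟨j, -, hj⟩ := Finset.exists_min_image Finset.univ ν ⟨i₀, Finset.mem_univ _⟩
  have hlt : ν j + 2 ≤ ν i := by
    have := hi i₀ (Finset.mem_univ _)
    have := hj j₀ (Finset.mem_univ _)
    omega
  have hne : i ≠ j := by rintro rfl; omega
  have hsj : s ≤ ν j := by
    have h1 : 0 < ∏ l, (ν l).descFactorial s := Nat.pos_of_mul_pos_right hpos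
    exact Nat.descFactorial_pos.1 (Nat.pos_of_ne_zero fun h0 =>
      h1.ne' (Finset.prod_eq_zero (Finset.mem_univ j) h0))
  have hmax : B + s + D₀ + 1 ≤ ν i := by
    by_contra! hcon
    have h1 : ∑ l, ν l < ∑ _l : Fin r, (B + s + D₀ + 1) :=
      Finset.sum_lt_sum_of_nonempty ⟨i, Finset.mem_univ _⟩ fun l _ =>
        lt_of_le_of_lt (hi l (Finset.mem_univ _)) hcon
    rw [hν, Finset.sum_const, Finset.card_univ, Fintype.card_fin, smul_eq_mul] at h1
    omega
  obtain ⟨b, hbj⟩ : ∃ b, ν j = b + s := ⟨ν j - s, by omega⟩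
  obtain ⟨D, hD⟩ : ∃ D, ν i = b + s + D + 1 := ⟨ν i - (b + s) - 1, by omega⟩
  refine ⟨Function.update (Function.update ν i (b + s + D)) j (b + s + 1),
    (sum_update_update_eq hne (by omega)).trans hν, partWeight_lt_update_update hne hpos ?_⟩
  rw [hbj, hD]
  refine pairWeight_lt_inward hs ?_
  rcases le_or_gt B b with hb | hb
  · exact hB b D hb (by omega)
  · -- the smallest part is bounded, so the difference `D` is large
    have hDlarge : D₀ ≤ D := by omega
    have hp : 0 < (b + D).descFactorial (d - 1) := Nat.descFactorial_pos.2 (by omega)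
    have hdD : d * (b + s + 1) < s * D := by
      calc d * (b + s + 1) ≤ d * (B + s + 1) := by gcongr
        _ < D := by omega
        _ ≤ s * D := Nat.le_mul_of_pos_left _ hs
    rcases Nat.eq_zero_or_pos d with rfl | hd0
    · simp only [Nat.descFactorial_zero]
      omega
    · obtain ⟨e, rfl⟩ := Nat.exists_eq_add_of_le' hd0
      rw [Nat.succ_descFactorial_succ, Nat.add_sub_cancel] at *
      calc (b + D + 1) * (b + s + 1) * ((e + 1) * (b + D).descFactorial e)
          = (e + 1) * (b + s + 1) * ((b + D + 1) * (b + D).descFactorial e) := by ring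
        _ < s * D * ((b + D + 1) * (b + D).descFactorial e) :=
          Nat.mul_lt_mul_of_pos_right hdD (by positivity)
        _ ≤ _ := by nlinarith [Nat.zero_le (s * D * b.descFactorial (e + 1)), Nat.zero_le ((b + D + 1) * (b + s + 1) * ((e + 1) * b.descFactorial e))]

end Exchange

/-! ### The limiting optimization problem -/

section EvenPart

/-- With `E` and `O` the even and the odd part of `∏ (1 + z i)`, one has `E' = E + z O` and
`O' = O + z E` when a factor is added. This lemma bounds `O` and `E` from below. -/
theorem prod_one_add_even_odd_lower (z : ℕ → ℝ) {u : ℝ} (hu : 0 ≤ u) (d : ℕ)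
    (hz : ∀ i < d, u ≤ z i) :
    2 * (d * u) ≤ (∏ i ∈ Finset.range d, (1 + z i)) - ∏ i ∈ Finset.range d, (1 - z i) ∧
    2 * (1 + d.choose 2 * u ^ 2) ≤
      (∏ i ∈ Finset.range d, (1 + z i)) + ∏ i ∈ Finset.range d, (1 - z i) := by
  induction d with
  | zero => norm_num
  | succ d ih =>
    obtain ⟨h1, h2⟩ := ih fun i hi => hz i (by omega)
    have hzd := hz d (by omega)
    rw [Finset.prod_range_succ, Finset.prod_range_succ, Nat.choose_succ_succ' d 1,
      Nat.choose_one_right]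
    generalize (∏ i ∈ Finset.range d, (1 + z i)) = p at *
    generalize (∏ i ∈ Finset.range d, (1 - z i)) = q at *
    have hc : (0 : ℝ) ≤ d.choose 2 * u ^ 2 := by positivity
    have hd : (0 : ℝ) ≤ 2 * (d * u) := by positivity
    push_cast
    constructor
    · have : u * 2 ≤ z d * (p + q) :=
        mul_le_mul hzd (by linarith) (by norm_num) (hu.trans hzd)
      linarith
    · have : u * (2 * (d * u)) ≤ z d * (p - q) := mul_le_mul hzd h1 hd (hu.trans hzd)
      linarith

/-- The corresponding bounds from above; `O ≤ d * u * E` gives `E' ≤ (1 + d * u ^ 2) * E`, and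
the factors `1 + i * u ^ 2 ≤ (1 + u ^ 2) ^ i` multiply to `(1 + u ^ 2) ^ d.choose 2`. -/
theorem prod_one_add_even_odd_upper (z : ℕ → ℝ) {u : ℝ} (d : ℕ)
    (hz : ∀ i < d, 0 ≤ z i ∧ z i ≤ u) :
    0 ≤ (∏ i ∈ Finset.range d, (1 + z i)) - ∏ i ∈ Finset.range d, (1 - z i) ∧
    2 ≤ (∏ i ∈ Finset.range d, (1 + z i)) + ∏ i ∈ Finset.range d, (1 - z i) ∧
    (∏ i ∈ Finset.range d, (1 + z i)) - ∏ i ∈ Finset.range d, (1 - z i) ≤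
      d * u * ((∏ i ∈ Finset.range d, (1 + z i)) + ∏ i ∈ Finset.range d, (1 - z i)) ∧
    (∏ i ∈ Finset.range d, (1 + z i)) + ∏ i ∈ Finset.range d, (1 - z i) ≤
      2 * (1 + u ^ 2) ^ d.choose 2 := by
  induction d with
  | zero => norm_num
  | succ d ih =>
    obtain ⟨h1, h2, h3, h4⟩ := ih fun i hi => hz i (by omega)
    obtain ⟨hz0, hzu⟩ := hz d (by omega)
    rw [Finset.prod_range_succ, Finset.prod_range_succ, Nat.choose_succ_succ' d 1,
      Nat.choose_one_right]
    generalize (∏ i ∈ Finset.range d, (1 + z i)) = p at *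
    generalize (∏ i ∈ Finset.range d, (1 - z i)) = q at *
    have hu : 0 ≤ u := hz0.trans hzu
    have e1 : p * (1 + z d) - q * (1 - z d) = (p - q) + z d * (p + q) := by ring
    have e2 : p * (1 + z d) + q * (1 - z d) = (p + q) + z d * (p - q) := by ring
    rw [e1, e2]
    generalize p + q = E at *
    generalize p - q = O at *
    have hzO : 0 ≤ z d * O := mul_nonneg hz0 h1
    have hzE : 0 ≤ z d * E := mul_nonneg hz0 (by linarith)
    have hdu : 0 ≤ (d : ℝ) * u := by positivity
    refine ⟨by linarith, by linarith, ?_, ?_⟩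
    · have a1 : z d * E ≤ u * E := mul_le_mul_of_nonneg_right hzu (by linarith)
      have a2 : 0 ≤ (d * u + u) * (z d * O) := mul_nonneg (by linarith) hzO
      push_cast
      linarith
    · have a1 : z d * O ≤ u * (d * u * E) := mul_le_mul hzu h3 h1 hu
      have a2 : 1 + (d : ℝ) * u ^ 2 ≤ (1 + u ^ 2) ^ d :=
        one_add_mul_le_pow (by nlinarith [sq_nonneg u]) d
      calc E + z d * O ≤ (1 + d * u ^ 2) * E := by linarith
        _ ≤ (1 + u ^ 2) ^ d * (2 * (1 + u ^ 2) ^ d.choose 2) := by gcongr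
        _ = _ := by rw [pow_add]; ring

theorem one_add_pow_add_one_sub_pow_lower {u : ℝ} (hu : 0 ≤ u) (d : ℕ) :
    2 * (1 + d.choose 2 * u ^ 2) ≤ (1 + u) ^ d + (1 - u) ^ d := by
  simpa using (prod_one_add_even_odd_lower (fun _ => u) hu d fun _ _ => le_rfl).2

theorem one_add_pow_add_one_sub_pow_upper {u : ℝ} (hu : 0 ≤ u) (d : ℕ) :
    (1 + u) ^ d + (1 - u) ^ d ≤ 2 * (1 + u ^ 2) ^ d.choose 2 := by
  simpa using (prod_one_add_even_odd_upper (fun _ => u) d fun _ _ => ⟨hu, le_rfl⟩).2.2.2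

end EvenPart

section Density

variable {ι : Type*} [Fintype ι]

/-- The leading term of `partWeight s d` at the part sizes `n * x i`. -/
noncomputable def partDensity (s d : ℕ) (x : ι → ℝ) : ℝ := (∏ i, x i) ^ s * ∑ i, x i ^ d

theorem continuous_partDensity (s d : ℕ) : Continuous (partDensity (ι := ι) s d) := by
  unfold partDensity
  fun_prop

theorem partDensity_const_mul (s d : ℕ) (c : ℝ) (x : ι → ℝ) :
    partDensity s d (fun i => c * x i) = c ^ (Fintype.card ι * s + d) * partDensity s d x := by
  unfold partDensity
  rw [Finset.prod_mul_distrib, Finset.prod_const, Finset.card_univ, mul_pow, ← pow_mul]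
  simp only [mul_pow, ← Finset.mul_sum]
  rw [pow_add]
  ring

theorem partWeight_le_partDensity (s d : ℕ) (ν : ι → ℕ) :
    (partWeight s d ν : ℝ) ≤ partDensity s d fun i => (ν i : ℝ) := by
  unfold partWeight partDensity
  rw [← Finset.prod_pow]
  push_cast
  gcongr with i _ i _
  · exact_mod_cast Nat.descFactorial_le_pow _ _
  · exact_mod_cast (Nat.descFactorial_le_pow _ _).trans (Nat.pow_le_pow_left (Nat.sub_le _ _) _)

theorem tendsto_sub_div {ν : ℕ → ℕ} {x : ℝ}
    (h : Tendsto (fun n => (ν n : ℝ) / n) atTop (nhds x)) (k : ℕ) :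
    Tendsto (fun n => ((ν n - k : ℕ) : ℝ) / n) atTop (nhds x) := by
  have h0 : Tendsto (fun n : ℕ => (k : ℝ) / n) atTop (nhds 0) :=
    tendsto_const_div_atTop_nhds_zero_nat _
  have hl := h.sub h0
  rw [sub_zero] at hl
  refine tendsto_of_tendsto_of_tendsto_of_le_of_le hl h (fun n => ?_) (fun n => ?_)
  · simp only [← sub_div]
    gcongr
    have : ν n ≤ (ν n - k) + k := by omega
    have : (ν n : ℝ) ≤ ((ν n - k : ℕ) : ℝ) + k := by exact_mod_cast this
    linarith
  · simp only
    gcongr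
    exact Nat.sub_le _ _

theorem tendsto_descFactorial_div {ν : ℕ → ℕ} {x : ℝ}
    (h : Tendsto (fun n => (ν n : ℝ) / n) atTop (nhds x)) (k : ℕ) :
    Tendsto (fun n => ((ν n).descFactorial k : ℝ) / (n : ℝ) ^ k) atTop (nhds (x ^ k)) := by
  induction k with
  | zero => simp
  | succ k ih =>
    rw [pow_succ']
    refine ((tendsto_sub_div h k).mul ih).congr fun n => ?_
    rw [Nat.descFactorial_succ, pow_succ', div_mul_div_comm]
    push_cast
    rfl

theorem tendsto_partWeight_div (s d : ℕ) {ν : ℕ → ι → ℕ} {x : ι → ℝ}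
    (h : ∀ i, Tendsto (fun n => (ν n i : ℝ) / n) atTop (nhds (x i))) :
    Tendsto (fun n => (partWeight s d (ν n) : ℝ) / (n : ℝ) ^ (Fintype.card ι * s + d)) atTop
      (nhds (partDensity s d x)) := by
  unfold partWeight partDensity
  rw [← Finset.prod_pow]
  have h1 := tendsto_finsetProd Finset.univ fun i _ => tendsto_descFactorial_div (h i) s
  have h2 := tendsto_finsetSum Finset.univ fun i _ =>
    tendsto_descFactorial_div (tendsto_sub_div (h i) s) d
  refine (h1.mul h2).congr fun n => ?_
  rw [Finset.prod_div_distrib, Finset.prod_const, Finset.card_univ, ← pow_mul, ← Finset.sum_div,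
    div_mul_div_comm, ← pow_add, mul_comm s]
  push_cast
  rfl

/-- Replacing two unequal sizes by their mean increases the density. With `x = m * (1 + u)` and
`y = m * (1 - u)`, the loss `(1 + u ^ 2) ^ s` in the second factor is more than compensated by
the gain `(1 - u ^ 2) ^ (-s)` in the first one. -/
theorem mul_pow_mul_lt_mean {s d : ℕ} (hs : 1 ≤ s) (hd : d.choose 2 ≤ s) {x y w : ℝ} (hy : 0 < y)
    (hxy : y < x) (hw : 0 ≤ w) :
    (x * y) ^ s * (x ^ d + y ^ d + w) <
      (((x + y) / 2) * ((x + y) / 2)) ^ s * (((x + y) / 2) ^ d + ((x + y) / 2) ^ d + w) := by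
  set m := (x + y) / 2 with hm
  have hm0 : 0 < m := by rw [hm]; linarith
  obtain ⟨u, hu⟩ : ∃ u, u = (x - y) / (x + y) := ⟨_, rfl⟩
  have hu0 : 0 < u := by rw [hu]; exact div_pos (by linarith) (by linarith)
  have hu1 : u < 1 := by rw [hu, div_lt_one (by linarith)]; linarith
  have hmu : m * u = (x - y) / 2 := by
    have hne : x + y ≠ 0 := by linarith
    rw [hm, hu]; field_simp
  have hx : x = m * (1 + u) := by rw [mul_add, hmu, hm]; ring
  have hy' : y = m * (1 - u) := by rw [mul_sub, hmu, hm]; ring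
  have e1 : x * y = m * m * (1 - u ^ 2) := by rw [hx, hy']; ring
  have hu2 : 0 < 1 - u ^ 2 := by nlinarith
  have hE : x ^ d + y ^ d ≤ 2 * m ^ d * (1 + u ^ 2) ^ s := by
    rw [hx, hy', mul_pow, mul_pow, ← mul_add]
    calc m ^ d * ((1 + u) ^ d + (1 - u) ^ d) ≤ m ^ d * (2 * (1 + u ^ 2) ^ d.choose 2) := by
          gcongr; exact one_add_pow_add_one_sub_pow_upper hu0.le d
      _ ≤ m ^ d * (2 * (1 + u ^ 2) ^ s) := by
          gcongr
          nlinarith [sq_nonneg u]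
      _ = _ := by ring
  have h1 : (1 - u ^ 2) ^ s * (1 + u ^ 2) ^ s < 1 := by
    rw [← mul_pow]
    exact pow_lt_one₀ (by positivity) (by nlinarith [pow_pos hu0 4]) (by omega)
  have h2 : (1 - u ^ 2) ^ s ≤ 1 := pow_le_one₀ hu2.le (by nlinarith)
  rw [e1, mul_pow, mul_assoc]
  refine mul_lt_mul_of_pos_left ?_ (by positivity)
  calc (1 - u ^ 2) ^ s * (x ^ d + y ^ d + w)
      ≤ (1 - u ^ 2) ^ s * (2 * m ^ d * (1 + u ^ 2) ^ s + w) := by gcongr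
    _ = 2 * m ^ d * ((1 - u ^ 2) ^ s * (1 + u ^ 2) ^ s) + (1 - u ^ 2) ^ s * w := by ring
    _ < 2 * m ^ d * 1 + 1 * w := by
      refine add_lt_add_of_lt_of_le ?_ (mul_le_mul_of_nonneg_right h2 hw)
      exact mul_lt_mul_of_pos_left h1 (by positivity)
    _ = _ := by ring

theorem partDensity_lt_of_lt [DecidableEq ι] {s d : ℕ} (hs : 1 ≤ s) (hd : d.choose 2 ≤ s)
    {x : ι → ℝ} (hx : ∀ i, 0 < x i) {i j : ι} (hij : x j < x i) :
    ∃ x' : ι → ℝ, (∀ l, 0 ≤ x' l) ∧ ∑ l, x' l = ∑ l, x l ∧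
      partDensity s d x < partDensity s d x' := by
  have hne : i ≠ j := by rintro rfl; exact lt_irrefl _ hij
  have hji : j ∈ Finset.univ.erase i := Finset.mem_erase.2 ⟨hne.symm, Finset.mem_univ j⟩
  have hi := Finset.mem_univ i
  set m := (x i + x j) / 2
  set x' := Function.update (Function.update x i m) j m with hx'
  have hm : 0 < m := by have := hx i; have := hx j; positivity
  have hxi : x' i = m := by rw [hx', Function.update_of_ne hne, Function.update_self]
  have hxj : x' j = m := by rw [hx', Function.update_self]
  have hoff : ∀ l ∈ (Finset.univ.erase i).erase j, x' l = x l := fun l hl => by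
    obtain ⟨h1, h2⟩ := Finset.mem_erase.1 hl
    rw [hx', Function.update_of_ne h1, Function.update_of_ne (Finset.mem_erase.1 h2).1]
  refine ⟨x', fun l => ?_, ?_, ?_⟩
  · by_cases h1 : l = j
    · rw [h1, hxj]; exact hm.le
    · by_cases h2 : l = i
      · rw [h2, hxi]; exact hm.le
      · rw [hoff l (by simp [h1, h2])]; exact (hx l).le
  · rw [← Finset.add_sum_erase _ _ hi, ← Finset.add_sum_erase _ _ hji,
      ← Finset.add_sum_erase _ x hi, ← Finset.add_sum_erase _ x hji, hxi, hxj,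
      Finset.sum_congr rfl hoff]
    ring
  · unfold partDensity
    rw [← Finset.mul_prod_erase _ _ hi, ← Finset.mul_prod_erase _ _ hji,
      ← Finset.mul_prod_erase _ x' hi, ← Finset.mul_prod_erase _ x' hji,
      ← Finset.add_sum_erase _ _ hi, ← Finset.add_sum_erase _ _ hji,
      ← Finset.add_sum_erase _ (fun l => x' l ^ d) hi,
      ← Finset.add_sum_erase _ (fun l => x' l ^ d) hji, hxi, hxj,
      Finset.prod_congr rfl hoff, Finset.sum_congr (g := fun l => x l ^ d) rfl
        fun l hl => show x' l ^ d = x l ^ d by rw [hoff l hl]]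
    set R := ∏ l ∈ (Finset.univ.erase i).erase j, x l
    set w := ∑ l ∈ (Finset.univ.erase i).erase j, x l ^ d
    have hR : 0 < R := Finset.prod_pos fun l _ => hx l
    have hw : 0 ≤ w := Finset.sum_nonneg fun l _ => (pow_pos (hx l) d).le
    have key : (x i * x j) ^ s * (x i ^ d + x j ^ d + w) * R ^ s <
        (m * m) ^ s * (m ^ d + m ^ d + w) * R ^ s :=
      mul_lt_mul_of_pos_right (mul_pow_mul_lt_mean hs hd (hx j) hij hw) (pow_pos hR s)
    calc (x i * (x j * R)) ^ s * (x i ^ d + (x j ^ d + w))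
        = (x i * x j) ^ s * (x i ^ d + x j ^ d + w) * R ^ s := by rw [← mul_assoc, mul_pow]; ring
      _ < _ := key
      _ = _ := by rw [← mul_assoc m m R, mul_pow]; ring_nf

/-- For `d.choose 2 ≤ s`, the density is largest at equal sizes: a maximum exists by
compactness, and averaging two unequal sizes would increase it. -/
theorem partDensity_le_of_mem_stdSimplex [Nonempty ι] {s d : ℕ} (hs : 1 ≤ s)
    (hd : d.choose 2 ≤ s) {x : ι → ℝ} (hx : x ∈ stdSimplex ℝ ι) :
    partDensity s d x ≤ partDensity s d fun _ : ι => (1 / Fintype.card ι : ℝ) := by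
  classical
  have hr : (0 : ℝ) < Fintype.card ι := by exact_mod_cast Fintype.card_pos
  have hc : (fun _ : ι => (1 / Fintype.card ι : ℝ)) ∈ stdSimplex ℝ ι :=
    ⟨fun _ => by positivity, by simp [hr.ne']⟩
  obtain ⟨y, hy, hmax⟩ := (isCompact_stdSimplex ℝ ι).exists_isMaxOn ⟨_, hc⟩
    (continuous_partDensity s d).continuousOn
  refine (hmax hx).trans ?_
  have hy0 : 0 < partDensity s d y := by
    refine lt_of_lt_of_le ?_ (hmax hc)
    have : 0 < ∑ _i : ι, (1 / Fintype.card ι : ℝ) ^ d :=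
      Finset.sum_pos (fun _ _ => by positivity) Finset.univ_nonempty
    unfold partDensity
    positivity
  have hpos : ∀ i, 0 < y i := fun i => by
    refine lt_of_le_of_ne (hy.1 i) fun h => hy0.ne' ?_
    rw [partDensity, Finset.prod_eq_zero (Finset.mem_univ i) h.symm, zero_pow (by omega), zero_mul]
  have hall : ∀ i j, y i ≤ y j := fun i j => by
    by_contra! hlt
    obtain ⟨x', h1, h2, h3⟩ := partDensity_lt_of_lt hs hd hpos hlt
    exact absurd (hmax (⟨h1, h2.trans hy.2⟩ : x' ∈ stdSimplex ℝ ι)) (not_le.2 h3)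
  have heq : y = fun _ => (1 / Fintype.card ι : ℝ) := by
    ext i
    have h1 : ∑ j, y j = ∑ _j : ι, y i :=
      Finset.sum_congr rfl fun j _ => le_antisymm (hall _ _) (hall _ _)
    rw [hy.2, Finset.sum_const, Finset.card_univ, nsmul_eq_mul] at h1
    field_simp
    linarith
  rw [heq]

end Density

theorem partWeight_le_of_sum_eq {r n s d : ℕ} (hr : 0 < r) (hn : 0 < n) (hs : 1 ≤ s)
    (hd : d.choose 2 ≤ s) {ν : Fin r → ℕ} (hν : ∑ i, ν i = n) :
    (partWeight s d ν : ℝ) ≤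
      (n : ℝ) ^ (r * s + d) * partDensity s d fun _ : Fin r => (1 / r : ℝ) := by
  have hn' : (0 : ℝ) < n := by exact_mod_cast hn
  have : Nonempty (Fin r) := ⟨⟨0, hr⟩⟩
  have hx : (fun i => (ν i : ℝ) / n) ∈ stdSimplex ℝ (Fin r) := by
    refine ⟨fun i => by positivity, ?_⟩
    rw [← Finset.sum_div, ← Nat.cast_sum, hν, div_self hn'.ne']
  have h1 := partDensity_le_of_mem_stdSimplex hs hd hx
  have h2 := partDensity_const_mul s d (n : ℝ) fun i => (ν i : ℝ) / n
  simp only [mul_div_cancel₀ _ hn'.ne', Fintype.card_fin] at h1 h2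
  refine (partWeight_le_partDensity s d ν).trans ?_
  rw [h2]
  gcongr

theorem tendsto_div_div (r : ℕ) :
    Tendsto (fun n : ℕ => ((n / r : ℕ) : ℝ) / n) atTop (nhds (1 / r : ℝ)) := by
  rcases Nat.eq_zero_or_pos r with rfl | hr
  · simp
  have hr' : (0 : ℝ) < r := by exact_mod_cast hr
  have h0 : Tendsto (fun n : ℕ => (1 : ℝ) / n) atTop (nhds 0) :=
    tendsto_const_div_atTop_nhds_zero_nat _
  have hl := h0.const_sub (1 / r : ℝ)
  rw [sub_zero] at hl
  refine tendsto_of_tendsto_of_tendsto_of_le_of_le' hl tendsto_const_nhds ?_ ?_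
  · filter_upwards [eventually_gt_atTop 0] with n hn
    have hn' : (0 : ℝ) < n := by exact_mod_cast hn
    have h1 : (n : ℝ) < r * ((n / r : ℕ) + 1) := by exact_mod_cast Nat.lt_mul_div_succ n hr
    rw [div_sub_div _ _ hr'.ne' hn'.ne', div_le_div_iff₀ (by positivity) hn']
    nlinarith
  · filter_upwards [eventually_gt_atTop 0] with n hn
    have hn' : (0 : ℝ) < n := by exact_mod_cast hn
    have h1 : ((n / r : ℕ) : ℝ) ≤ n / r := Nat.cast_div_le
    rw [div_le_iff₀ hn']
    linarith [one_div_mul_eq_div (r : ℝ) (n : ℝ)]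

theorem tendsto_turanPart_div {r : ℕ} (i : Fin r) :
    Tendsto (fun n : ℕ => (turanPart n r i : ℝ) / n) atTop (nhds (1 / r : ℝ)) := by
  have h0 : Tendsto (fun n : ℕ => (1 : ℝ) / n) atTop (nhds 0) :=
    tendsto_const_div_atTop_nhds_zero_nat _
  have hu := (tendsto_div_div r).add h0
  rw [add_zero] at hu
  refine tendsto_of_tendsto_of_tendsto_of_le_of_le (tendsto_div_div r) hu (fun n => ?_)
    (fun n => ?_)
  · simp only [turanPart]
    gcongr
    omega
  · simp only [turanPart, ← add_div]
    gcongr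
    split_ifs <;> simp

/-- For `r * s < d * (d - 1)`, equal sizes do not maximize the density. -/
theorem exists_partDensity_gt {r s d : ℕ} (hs : 1 ≤ s) (hd : r * s < 2 * d.choose 2) :
    ∃ u : ℝ, 0 < u ∧ u < 1 ∧
      (r : ℝ) < (1 - u ^ 2) ^ s * ((1 + u) ^ d + (1 - u) ^ d + (r - 2)) := by
  set q : ℝ := 2 * d.choose 2 with hq
  have hq1 : (r * s : ℝ) < q := by rw [hq]; exact_mod_cast hd
  have hs' : (1 : ℝ) ≤ s := by exact_mod_cast hs
  have hr0 : (0 : ℝ) ≤ r * s := by positivity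
  have hq0 : 0 < q := by linarith
  -- the second-order gain `q * u ^ 2 - r * s * u ^ 2` has to beat the fourth-order term
  set δ : ℝ := (q - r * s) / (s * q) with hδ
  have hδ0 : 0 < δ := div_pos (by linarith) (by positivity)
  refine ⟨min (1 / 2) δ, by positivity, (min_le_left _ _).trans_lt (by norm_num), ?_⟩
  set u := min (1 / 2) δ
  have hu0 : 0 < u := by positivity
  have hu1 : u ≤ 1 / 2 := min_le_left _ _
  have hu2 : u ^ 2 * (s * q) < q - r * s := by
    have : u ^ 2 < δ := by
      have : u ≤ δ := min_le_right _ _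
      nlinarith
    rwa [hδ, lt_div_iff₀ (by positivity)] at this
  have h1 := one_add_pow_add_one_sub_pow_lower hu0.le d
  have h2 : 1 - s * u ^ 2 ≤ (1 - u ^ 2) ^ s := by
    have := one_add_mul_le_pow (a := -u ^ 2) (by nlinarith) s
    simpa [← sub_eq_add_neg] using this
  have h3 : 0 ≤ (1 - u ^ 2) ^ s := pow_nonneg (by nlinarith) s
  have h4 : (0 : ℝ) ≤ r + q * u ^ 2 := by positivity
  calc (r : ℝ) < (1 - s * u ^ 2) * (r + q * u ^ 2) := by
        have := mul_lt_mul_of_pos_right hu2 (pow_pos hu0 2)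
        linarith
    _ ≤ (1 - u ^ 2) ^ s * (r + q * u ^ 2) := by gcongr
    _ ≤ _ := by
        refine mul_le_mul_of_nonneg_left ?_ h3
        rw [hq]
        linarith

/-- For `r * s < d * (d - 1)`, the weight of the Turán part sizes can be exceeded by a constant
factor. -/
theorem eventually_exists_mul_partWeight_le {r s d : ℕ} (hr : 2 ≤ r) (hs : 1 ≤ s)
    (hd : r * s < 2 * d.choose 2) :
    ∃ c : ℝ, 0 < c ∧ ∀ᶠ n : ℕ in atTop, ∃ ν : Fin r → ℕ, ∑ i, ν i = n ∧
      (1 + c) * (partWeight s d (turanPart n r) : ℝ) ≤ partWeight s d ν := by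
  obtain ⟨u, hu0, hu1, hu⟩ := exists_partDensity_gt hs hd
  have hr0 : (0 : ℝ) < r := by exact_mod_cast (by omega : 0 < r)
  let i : Fin r := ⟨0, by omega⟩
  let j : Fin r := ⟨1, by omega⟩
  have hne : i ≠ j := by simp [i, j]
  have hi := Finset.mem_univ i
  have hji : j ∈ Finset.univ.erase i := Finset.mem_erase.2 ⟨hne.symm, Finset.mem_univ j⟩
  let k : ℕ → ℕ := fun n => ⌊u / r * n⌋₊
  have hk : Tendsto (fun n => (k n : ℝ) / n) atTop (nhds (u / r)) :=
    (tendsto_nat_floor_mul_div_atTop (R := ℝ) (by positivity)).comp tendsto_natCast_atTop_atTop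
  have hkle : ∀ n, k n ≤ turanPart n r j := fun n => by
    refine le_trans ?_ (Nat.le_add_right (n / r) _)
    rw [Nat.le_div_iff_mul_le (by omega)]
    have h1 : (k n : ℝ) ≤ u / r * n := Nat.floor_le (by positivity)
    have h2 : (k n : ℝ) * r ≤ n := by
      calc (k n : ℝ) * r ≤ u / r * n * r := by gcongr
        _ = u * n := by field_simp
        _ ≤ n := by nlinarith [Nat.cast_nonneg (α := ℝ) n]
    exact_mod_cast h2
  let ν : ℕ → Fin r → ℕ := fun n => Function.update (Function.update (turanPart n r) i
    (turanPart n r i + k n)) j (turanPart n r j - k n)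
  let x : Fin r → ℝ := Function.update (Function.update (fun _ => 1 / r) i (1 / r + u / r)) j
    (1 / r - u / r)
  have hνx : ∀ l, Tendsto (fun n => (ν n l : ℝ) / n) atTop (nhds (x l)) := fun l => by
    by_cases hlj : l = j
    · rw [hlj]
      simp only [ν, x, Function.update_self]
      refine ((tendsto_turanPart_div j).sub hk).congr fun n => ?_
      rw [Nat.cast_sub (hkle n), sub_div]
    · by_cases hli : l = i
      · rw [hli]
        simp only [ν, x, Function.update_of_ne hne, Function.update_self]
        refine ((tendsto_turanPart_div i).add hk).congr fun n => ?_
        rw [Nat.cast_add, add_div]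
      · simp only [ν, x, Function.update_of_ne hlj, Function.update_of_ne hli]
        exact tendsto_turanPart_div l
  have hT := tendsto_partWeight_div s d (ν := fun n => turanPart n r) (x := fun _ : Fin r =>
    (1 / r : ℝ)) fun i => tendsto_turanPart_div i
  have hN := tendsto_partWeight_div s d hνx
  have hlt : partDensity s d (fun _ : Fin r => (1 / r : ℝ)) < partDensity s d x := by
    have hoff : ∀ l ∈ (Finset.univ.erase i).erase j, x l = 1 / r := fun l hl => by
      obtain ⟨h1, h2⟩ := Finset.mem_erase.1 hl
      simp only [x, Function.update_of_ne h1, Function.update_of_ne (Finset.mem_erase.1 h2).1]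
    have hxi : x i = 1 / r * (1 + u) := by
      simp only [x, Function.update_of_ne hne, Function.update_self]; ring
    have hxj : x j = 1 / r * (1 - u) := by simp only [x, Function.update_self]; ring
    have hcard : ((Finset.univ.erase i).erase j).card = r - 2 := by
      rw [Finset.card_erase_of_mem hji, Finset.card_erase_of_mem hi, Finset.card_univ,
        Fintype.card_fin]
      omega
    have hprod : ∏ l, x l = (1 / r) ^ r * (1 - u ^ 2) := by
      rw [← Finset.mul_prod_erase _ _ hi, ← Finset.mul_prod_erase _ _ hji,
        Finset.prod_congr rfl hoff, hxi, hxj, Finset.prod_const, hcard]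
      obtain ⟨r', rfl⟩ := Nat.exists_eq_add_of_le' hr
      rw [Nat.add_sub_cancel]
      ring
    have hsum : ∑ l, x l ^ d = (1 / r) ^ d * ((1 + u) ^ d + (1 - u) ^ d + (r - 2)) := by
      rw [← Finset.add_sum_erase _ _ hi, ← Finset.add_sum_erase _ _ hji,
        Finset.sum_congr (g := fun _ => (1 / r : ℝ) ^ d) rfl
          fun l hl => show x l ^ d = _ by rw [hoff l hl], hxi, hxj, Finset.sum_const, hcard,
        nsmul_eq_mul, Nat.cast_sub hr, mul_pow, mul_pow]
      push_cast
      ring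
    unfold partDensity
    rw [hprod, hsum, Finset.prod_const, Finset.sum_const, Finset.card_univ, Fintype.card_fin,
      nsmul_eq_mul, mul_pow]
    have hC : (0 : ℝ) < ((1 / r) ^ r) ^ s * (1 / r) ^ d := by positivity
    calc (((1 : ℝ) / r) ^ r) ^ s * (r * (1 / r) ^ d)
        = ((1 / r) ^ r) ^ s * (1 / r) ^ d * r := by ring
      _ < ((1 / r) ^ r) ^ s * (1 / r) ^ d *
          ((1 - u ^ 2) ^ s * ((1 + u) ^ d + (1 - u) ^ d + (r - 2))) :=
        mul_lt_mul_of_pos_left hu hC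
      _ = _ := by ring
  have hpos : 0 < partDensity s d (fun _ : Fin r => (1 / r : ℝ)) := by
    unfold partDensity
    rw [Finset.sum_const, Finset.card_univ, Fintype.card_fin, nsmul_eq_mul]
    positivity
  obtain ⟨c, hc1, hc2⟩ := exists_between ((one_lt_div hpos).2 hlt)
  rw [lt_div_iff₀ hpos] at hc2
  refine ⟨c - 1, by linarith, ?_⟩
  filter_upwards [(hT.const_mul c).eventually_lt hN hc2, eventually_gt_atTop 0] with n hn hn0
  have hsumn : ∑ l, ν n l = n := by
    refine (sum_update_update_eq hne ?_).trans (sum_turanPart n (by omega))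
    have := hkle n
    omega
  refine ⟨ν n, hsumn, ?_⟩
  have hn' : (0 : ℝ) < (n : ℝ) ^ (Fintype.card (Fin r) * s + d) := by positivity
  rw [← mul_div_assoc, div_lt_div_iff_of_pos_right hn'] at hn
  rw [add_sub_cancel]
  exact hn.le

/-! ### Two parts in the critical case -/

section Critical

theorem cast_descFactorial_eq_prod (N k : ℕ) :
    (N.descFactorial k : ℝ) = ∏ i ∈ Finset.range k, ((N : ℝ) - i) := by
  induction k with
  | zero => simp
  | succ k ih =>
    rw [Nat.descFactorial_succ, Finset.prod_range_succ, ← ih, Nat.cast_mul, mul_comm]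
    rcases le_or_gt k N with h | h
    · rw [Nat.cast_sub h]
    · rw [Nat.descFactorial_eq_zero_iff_lt.2 h]
      simp

/-- The weight of the two part sizes `M + κ` and `M - κ`, as a function of real arguments. -/
noncomputable def centeredWeight (s d : ℕ) (M κ : ℝ) : ℝ :=
  (∏ i ∈ Finset.range s, ((M - i) ^ 2 - κ ^ 2)) *
    ((∏ i ∈ Finset.range d, (M - s - i + κ)) + ∏ i ∈ Finset.range d, (M - s - i - κ))

theorem partWeight_eq_centeredWeight (s d : ℕ) {M κ : ℝ} (ν : Fin 2 → ℕ) (h0 : s ≤ ν 0)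
    (h1 : s ≤ ν 1) (hx : (ν 0 : ℝ) = M + κ) (hy : (ν 1 : ℝ) = M - κ) :
    (partWeight s d ν : ℝ) = centeredWeight s d M κ := by
  rw [partWeight, Fin.prod_univ_two, Fin.sum_univ_two, centeredWeight]
  push_cast
  simp only [cast_descFactorial_eq_prod, Nat.cast_sub h0, Nat.cast_sub h1]
  rw [← Finset.prod_mul_distrib, hx, hy]
  congr 1
  · exact Finset.prod_congr rfl fun i _ => by ring
  · congr 1 <;> exact Finset.prod_congr rfl fun i _ => by ring

/-- The two products in the second factor of `centeredWeight`, normalized by their value at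
`κ = 0`. -/
theorem prod_add_prod_eq (s d : ℕ) {M : ℝ} (κ : ℝ) (hM : (s + d : ℝ) ≤ M) :
    (∏ i ∈ Finset.range d, (M - s - i + κ)) + ∏ i ∈ Finset.range d, (M - s - i - κ) =
      (∏ i ∈ Finset.range d, (M - s - i)) *
        ((∏ i ∈ Finset.range d, (1 + κ / (M - s - i))) +
          ∏ i ∈ Finset.range d, (1 - κ / (M - s - i))) := by
  rw [mul_add, ← Finset.prod_mul_distrib, ← Finset.prod_mul_distrib]
  have hne : ∀ i ∈ Finset.range d, M - s - i ≠ 0 := fun i hi => by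
    have : (i : ℝ) + 1 ≤ d := by exact_mod_cast Finset.mem_range.1 hi
    linarith
  congr 1
  · exact Finset.prod_congr rfl fun i hi => by have := hne i hi; field_simp
  · exact Finset.prod_congr rfl fun i hi => by have := hne i hi; field_simp

/-- Expansion of the weight around equal parts, from below. -/
theorem le_centeredWeight {s d : ℕ} (hs : 1 ≤ s) (hd : d.choose 2 = s) {M κ : ℝ}
    (hM : (s + d : ℝ) < M) (hκ0 : 0 ≤ κ) (hκ : κ ≤ M - s) :
    2 * ((∏ i ∈ Finset.range s, (M - i) ^ 2) * ∏ i ∈ Finset.range d, (M - s - i)) *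
      ((1 - s * κ ^ 2 / (M - s + 1) ^ 2) * (1 + s * κ ^ 2 / (M - s) ^ 2)) ≤
        centeredWeight s d M κ := by
  have hd0 : (0 : ℝ) ≤ d := by positivity
  have hMs : 0 < M - s := by linarith
  have hA : ∀ i ∈ Finset.range d, 0 < M - s - i := fun i hi => by
    have : (i : ℝ) + 1 ≤ d := by exact_mod_cast Finset.mem_range.1 hi
    linarith
  have hu : κ ^ 2 / (M - s + 1) ^ 2 ≤ 1 := by
    rw [div_le_one (by positivity)]
    exact pow_le_pow_left₀ hκ0 (by linarith) 2
  have h1 : (∏ i ∈ Finset.range s, (M - i) ^ 2) * (1 - s * κ ^ 2 / (M - s + 1) ^ 2) ≤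
      ∏ i ∈ Finset.range s, ((M - i) ^ 2 - κ ^ 2) := by
    calc (∏ i ∈ Finset.range s, (M - i) ^ 2) * (1 - s * κ ^ 2 / (M - s + 1) ^ 2)
        ≤ (∏ i ∈ Finset.range s, (M - i) ^ 2) * (1 - κ ^ 2 / (M - s + 1) ^ 2) ^ s := by
          refine mul_le_mul_of_nonneg_left ?_ (Finset.prod_nonneg fun i _ => sq_nonneg _)
          have := one_add_mul_le_pow (a := -(κ ^ 2 / (M - s + 1) ^ 2)) (by linarith) s
          rwa [mul_neg, ← sub_eq_add_neg, ← sub_eq_add_neg, ← mul_div_assoc] at this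
      _ = ∏ i ∈ Finset.range s, (M - i) ^ 2 * (1 - κ ^ 2 / (M - s + 1) ^ 2) := by
          rw [Finset.prod_mul_distrib, Finset.prod_const, Finset.card_range]
      _ ≤ _ := by
          refine Finset.prod_le_prod (fun i _ => mul_nonneg (sq_nonneg _) (by linarith))
            fun i hi => ?_
          have hi' : (i : ℝ) + 1 ≤ s := by exact_mod_cast Finset.mem_range.1 hi
          have : κ ^ 2 ≤ (M - i) ^ 2 * (κ ^ 2 / (M - s + 1) ^ 2) := by
            rw [← mul_div_assoc, le_div_iff₀ (by positivity), mul_comm]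
            gcongr
            linarith
          linarith
  have h2 := (prod_one_add_even_odd_lower (fun i => κ / (M - s - i)) (u := κ / (M - s))
    (by positivity) d fun i hi => by
      have := hA i (Finset.mem_range.2 hi)
      exact div_le_div_of_nonneg_left hκ0 this (by linarith [Nat.cast_nonneg (α := ℝ) i])).2
  rw [hd, div_pow, ← mul_div_assoc] at h2
  rw [centeredWeight, prod_add_prod_eq s d κ hM.le]
  have hP : 0 < ∏ i ∈ Finset.range d, (M - s - i) := Finset.prod_pos hA
  have hF : 0 ≤ ∏ i ∈ Finset.range s, ((M - i) ^ 2 - κ ^ 2) :=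
    Finset.prod_nonneg fun i hi => by
      have hi' : (i : ℝ) + 1 ≤ s := by exact_mod_cast Finset.mem_range.1 hi
      exact sub_nonneg.2 (pow_le_pow_left₀ hκ0 (by linarith) 2)
  have h3 : 0 ≤ 2 * (1 + s * κ ^ 2 / (M - s) ^ 2) := by positivity
  calc _ = (∏ i ∈ Finset.range s, (M - i) ^ 2) * (1 - s * κ ^ 2 / (M - s + 1) ^ 2) *
        ((∏ i ∈ Finset.range d, (M - s - i)) * (2 * (1 + s * κ ^ 2 / (M - s) ^ 2))) := by ring
    _ ≤ (∏ i ∈ Finset.range s, ((M - i) ^ 2 - κ ^ 2)) *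
        ((∏ i ∈ Finset.range d, (M - s - i)) * (2 * (1 + s * κ ^ 2 / (M - s) ^ 2))) :=
      mul_le_mul_of_nonneg_right h1 (mul_nonneg hP.le h3)
    _ ≤ _ := mul_le_mul_of_nonneg_left (mul_le_mul_of_nonneg_left h2 hP.le) hF

/-- Expansion of the weight around equal parts, from above. -/
theorem centeredWeight_le {s d : ℕ} (hd : d.choose 2 = s) {M κ : ℝ}
    (hM : (s + d : ℝ) < M) (hκ0 : 0 ≤ κ) (hκ : κ ≤ M - s) :
    centeredWeight s d M κ ≤
      2 * ((∏ i ∈ Finset.range s, (M - i) ^ 2) * ∏ i ∈ Finset.range d, (M - s - i)) *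
        ((1 - κ ^ 2 / M ^ 2) * (1 + κ ^ 2 / (M - (s + d)) ^ 2)) ^ s := by
  have hd0 : (0 : ℝ) ≤ d := by positivity
  have hs0 : (0 : ℝ) ≤ s := by positivity
  have hM0 : 0 < M := by linarith
  have hA : ∀ i ∈ Finset.range d, M - (s + d) ≤ M - s - i := fun i hi => by
    have : (i : ℝ) + 1 ≤ d := by exact_mod_cast Finset.mem_range.1 hi
    linarith
  have h1 : ∏ i ∈ Finset.range s, ((M - i) ^ 2 - κ ^ 2) ≤
      (∏ i ∈ Finset.range s, (M - i) ^ 2) * (1 - κ ^ 2 / M ^ 2) ^ s := by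
    rw [← Finset.card_range s, ← Finset.prod_const, Finset.card_range, ← Finset.prod_mul_distrib]
    refine Finset.prod_le_prod (fun i hi => ?_) fun i hi => ?_
    all_goals have hi' : (i : ℝ) + 1 ≤ s := by exact_mod_cast Finset.mem_range.1 hi
    · exact sub_nonneg.2 (pow_le_pow_left₀ hκ0 (by linarith) 2)
    · have : (M - i) ^ 2 * (κ ^ 2 / M ^ 2) ≤ κ ^ 2 := by
        rw [← mul_div_assoc, div_le_iff₀ (by positivity), mul_comm]
        have h0 : (0 : ℝ) ≤ i := Nat.cast_nonneg i
        gcongr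
        · linarith
        · linarith
      linarith
  obtain ⟨-, h2a, -, h2⟩ := prod_one_add_even_odd_upper (fun i => κ / (M - s - i))
    (u := κ / (M - (s + d))) d fun i hi => by
      have := hA i (Finset.mem_range.2 hi)
      exact ⟨div_nonneg hκ0 (by linarith), by gcongr⟩
  rw [hd, div_pow] at h2
  rw [centeredWeight, prod_add_prod_eq s d κ hM.le, mul_pow]
  have hP : 0 < ∏ i ∈ Finset.range d, (M - s - i) :=
    Finset.prod_pos fun i hi => by have := hA i hi; linarith
  have hR : 0 ≤ (∏ i ∈ Finset.range s, (M - i) ^ 2) * (1 - κ ^ 2 / M ^ 2) ^ s := by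
    refine mul_nonneg (Finset.prod_nonneg fun i _ => sq_nonneg _) (pow_nonneg (sub_nonneg.2 ?_) s)
    rw [div_le_one (by positivity)]
    exact pow_le_pow_left₀ hκ0 (by linarith) 2
  calc _ ≤ (∏ i ∈ Finset.range s, (M - i) ^ 2) * (1 - κ ^ 2 / M ^ 2) ^ s *
        ((∏ i ∈ Finset.range d, (M - s - i)) *
          (2 * (1 + κ ^ 2 / (M - (s + d)) ^ 2) ^ s)) :=
      mul_le_mul h1 (mul_le_mul_of_nonneg_left h2 hP.le)
        (mul_nonneg hP.le (by linarith)) hR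
    _ = _ := by ring

theorem one_add_pow_le {x : ℝ} (hx : 0 ≤ x) (hx1 : x ≤ 1) (s : ℕ) :
    (1 + x) ^ s ≤ 1 + 3 ^ s * x := by
  induction s with
  | zero => simpa using hx
  | succ s ih =>
    have h3 : (1 : ℝ) ≤ 3 ^ s := one_le_pow₀ (by norm_num)
    have h4 : 0 ≤ (3 : ℝ) ^ s * x * (1 - x) := by
      have : 0 ≤ 1 - x := by linarith
      positivity
    have h5 : 0 ≤ ((3 : ℝ) ^ s - 1) * x := mul_nonneg (by linarith) hx
    calc (1 + x) ^ (s + 1) ≤ (1 + 3 ^ s * x) * (1 + x) := by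
          rw [pow_succ]; gcongr
      _ ≤ _ := by rw [pow_succ]; linarith

/-- The gain from a deviation `κ` with `s * κ ^ 2 = a`; here `z = M - s`. -/
theorem one_add_le_of_deviation {M z a : ℝ} (hz : M - z ≤ M / 256) (hz0 : 0 < z)
    (hzM : z + 1 ≤ M) (hM : 0 < M) (hal : M / 64 ≤ a) (hau : a ≤ M / 2) :
    1 + 1 / (64 * M ^ 2) ≤ (1 - a / (z + 1) ^ 2) * (1 + a / z ^ 2) := by
  have e1 : (1 - a / (z + 1) ^ 2) * (1 + a / z ^ 2) =
      1 + a * (2 * z + 1 - a) / (z ^ 2 * (z + 1) ^ 2) := by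
    have : z + 1 ≠ 0 := by linarith
    field_simp
    ring
  have h1 : M / 64 * M ≤ a * (2 * z + 1 - a) :=
    mul_le_mul hal (by linarith) hM.le (by linarith)
  have h2 : z ^ 2 * (z + 1) ^ 2 ≤ M ^ 2 * M ^ 2 := by
    gcongr
    linarith
  rw [e1]
  have h3 : 1 / (64 * M ^ 2) = M / 64 * M / (M ^ 2 * M ^ 2) := by field_simp
  rw [h3]
  have h4 : 0 ≤ a * (2 * z + 1 - a) := le_trans (by positivity) h1
  gcongr

/-- The deviation `κ₀ ≤ 1 / 2` of balanced parts of an odd number of vertices is negligible, since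
`1 / (M - t) ^ 2` and `1 / M ^ 2` differ only by `O(M⁻³)`. -/
theorem pow_le_one_add_of_deviation {M t κ₀ : ℝ} (s : ℕ) (ht : 1 ≤ t) (htM : 256 * t ≤ M)
    (hM : 256 * 3 ^ s * t ≤ M) (hκ₀ : 0 ≤ κ₀) (hκ₀' : κ₀ ≤ 1 / 2) :
    ((1 - κ₀ ^ 2 / M ^ 2) * (1 + κ₀ ^ 2 / (M - t) ^ 2)) ^ s ≤ 1 + 1 / (128 * M ^ 2) := by
  have hM0 : 0 < M := by linarith
  have hMt : 0 < M - t := by linarith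
  have hk : κ₀ ^ 2 ≤ 1 / 4 := by nlinarith
  have hbase : (1 - κ₀ ^ 2 / M ^ 2) * (1 + κ₀ ^ 2 / (M - t) ^ 2) ≤ 1 + 2 * t / M ^ 3 := by
    have e1 : 1 / (M - t) ^ 2 - 1 / M ^ 2 ≤ 8 * t / M ^ 3 := by
      have e2 : 1 / (M - t) ^ 2 - 1 / M ^ 2 = t * (2 * M - t) / ((M - t) ^ 2 * M ^ 2) := by
        field_simp
        ring
      have e3 : 8 * t / M ^ 3 = t * (2 * M) / ((M / 2) ^ 2 * M ^ 2) := by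
        field_simp
        ring
      rw [e2, e3]
      have ht0 : 0 ≤ t := by linarith
      gcongr
      · linarith
      · linarith
    have e4 : 0 ≤ κ₀ ^ 2 / M ^ 2 * (κ₀ ^ 2 / (M - t) ^ 2) := by positivity
    have e5 : κ₀ ^ 2 * (1 / (M - t) ^ 2 - 1 / M ^ 2) ≤ 1 / 4 * (8 * t / M ^ 3) := by
      have ht0 : 0 ≤ t := by linarith
      exact mul_le_mul hk e1 (sub_nonneg.2 (by gcongr; linarith)) (by norm_num)
    calc _ = 1 + κ₀ ^ 2 * (1 / (M - t) ^ 2 - 1 / M ^ 2) -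
          κ₀ ^ 2 / M ^ 2 * (κ₀ ^ 2 / (M - t) ^ 2) := by ring
      _ ≤ 1 + 1 / 4 * (8 * t / M ^ 3) := by linarith
      _ = _ := by ring
  have hnn : 0 ≤ (1 - κ₀ ^ 2 / M ^ 2) * (1 + κ₀ ^ 2 / (M - t) ^ 2) := by
    refine mul_nonneg (sub_nonneg.2 ?_) (by positivity)
    rw [div_le_one (by positivity)]
    nlinarith
  have ht0 : 0 ≤ t := by linarith
  have hx1 : 2 * t / M ^ 3 ≤ 1 := by
    rw [div_le_one (by positivity)]
    nlinarith [sq_nonneg M, mul_pos hM0 hM0]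
  calc _ ≤ (1 + 2 * t / M ^ 3) ^ s := pow_le_pow_left₀ hnn hbase s
    _ ≤ 1 + 3 ^ s * (2 * t / M ^ 3) := one_add_pow_le (by positivity) hx1 s
    _ ≤ _ := by
      have : 3 ^ s * (2 * t / M ^ 3) = (256 * 3 ^ s * t) / (128 * M ^ 3) := by
        field_simp; ring
      have h5 : 1 / (128 * M ^ 2) = M / (128 * M ^ 3) := by field_simp
      rw [this, h5]
      gcongr

/-- Moving the deviation from `κ₀ ≤ 1 / 2` to `κ` of order `√M` increases the weight by the
factor `1 + Ω(M⁻²)`: the terms of orders `κ² / M²` cancel for `d.choose 2 = s`, and what remains is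
a gain of order `κ² / M³` against a loss of order `κ⁴ / M⁴`. -/
theorem centeredWeight_gain {s d : ℕ} (hs : 1 ≤ s) (hd : d.choose 2 = s) {M κ κ₀ : ℝ}
    (hM : 256 * 3 ^ s * (s + d : ℝ) ≤ M) (hκ₀ : 0 ≤ κ₀) (hκ₀' : κ₀ ≤ 1 / 2)
    (hκ : 0 ≤ κ) (hκl : M / 64 ≤ s * κ ^ 2) (hκu : s * κ ^ 2 ≤ M / 2) :
    centeredWeight s d M κ₀ + (M / 2) ^ (2 * s + d) / (64 * M ^ 2) ≤
      centeredWeight s d M κ := by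
  have hs1 : (1 : ℝ) ≤ s := by exact_mod_cast hs
  have hd0 : (0 : ℝ) ≤ d := by positivity
  have h3 : (1 : ℝ) ≤ 3 ^ s := one_le_pow₀ (by norm_num)
  obtain ⟨t, ht⟩ : ∃ t : ℝ, t = s + d := ⟨_, rfl⟩
  have htM : 256 * t ≤ M := by
    refine le_trans ?_ hM
    rw [← ht]
    have : 0 ≤ (3 ^ s - 1) * t := mul_nonneg (by linarith) (by linarith)
    linarith
  have hM0 : 0 < M := by linarith
  have hM256 : 256 ≤ M := by linarith
  have hMs : 0 < M - s := by linarith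
  have hκM : κ ≤ M - s := by
    have h1 : κ ^ 2 ≤ M / 2 := by nlinarith [sq_nonneg κ]
    refine le_of_sq_le_sq ?_ hMs.le
    have h2 : M / 2 ≤ M - s := by linarith
    nlinarith
  have hlow := le_centeredWeight hs hd (M := M) (by linarith) hκ hκM
  have hup := centeredWeight_le hd (M := M) (by linarith) hκ₀ (by linarith)
  set G := (∏ i ∈ Finset.range s, (M - i) ^ 2) * ∏ i ∈ Finset.range d, (M - s - i) with hG
  have hGlow : (M / 2) ^ (2 * s + d) ≤ G := by
    rw [hG, pow_add, pow_mul]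
    refine mul_le_mul ?_ ?_ (by positivity) (Finset.prod_nonneg fun i _ => sq_nonneg _)
    · calc ((M / 2) ^ 2) ^ s = ∏ _i ∈ Finset.range s, (M / 2) ^ 2 := by
            rw [Finset.prod_const, Finset.card_range]
        _ ≤ _ := Finset.prod_le_prod (fun i _ => by positivity) fun i hi => by
          have : (i : ℝ) + 1 ≤ s := by exact_mod_cast Finset.mem_range.1 hi
          exact pow_le_pow_left₀ (by positivity) (by linarith) 2
    · calc (M / 2) ^ d = ∏ _i ∈ Finset.range d, M / 2 := by
            rw [Finset.prod_const, Finset.card_range]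
        _ ≤ _ := Finset.prod_le_prod (fun i _ => by positivity) fun i hi => by
          have : (i : ℝ) + 1 ≤ d := by exact_mod_cast Finset.mem_range.1 hi
          linarith
  have hG0 : 0 < G := lt_of_lt_of_le (by positivity) hGlow
  have hfac1 : 1 + 1 / (64 * M ^ 2) ≤
      (1 - s * κ ^ 2 / (M - s + 1) ^ 2) * (1 + s * κ ^ 2 / (M - s) ^ 2) :=
    one_add_le_of_deviation (by linarith) hMs (by linarith) hM0 hκl hκu
  have hfac2 := pow_le_one_add_of_deviation s (by linarith) htM (by rwa [ht]) hκ₀ hκ₀'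
  rw [ht] at hfac2
  calc centeredWeight s d M κ₀ + (M / 2) ^ (2 * s + d) / (64 * M ^ 2)
      ≤ 2 * G * (1 + 1 / (128 * M ^ 2)) + G / (64 * M ^ 2) := by
        refine add_le_add (hup.trans ?_) (by gcongr)
        exact mul_le_mul_of_nonneg_left hfac2 (by linarith)
    _ = 2 * G * (1 + 1 / (64 * M ^ 2)) := by field_simp; ring
    _ ≤ 2 * G * ((1 - s * κ ^ 2 / (M - s + 1) ^ 2) * (1 + s * κ ^ 2 / (M - s) ^ 2)) :=
        mul_le_mul_of_nonneg_left hfac1 (by linarith)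
    _ ≤ _ := hlow

/-- In the critical case `d.choose 2 = s`, two parts whose sizes differ by about `√n` have a
weight that exceeds that of two equal parts by a term of order `n ^ (2 * s + d - 2)`. -/
theorem exists_partWeight_add_le {s d : ℕ} (hs : 1 ≤ s) (hd : d.choose 2 = s) :
    ∃ c : ℝ, 0 < c ∧ ∀ᶠ n : ℕ in atTop, ∃ ν : Fin 2 → ℕ, ∑ i, ν i = n ∧
      (partWeight s d (turanPart n 2) : ℝ) + c * (n : ℝ) ^ (2 * s + d - 2) ≤
        partWeight s d ν := by
  refine ⟨(1 / 4) ^ (2 * s + d) / 16, by positivity, ?_⟩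
  filter_upwards [eventually_ge_atTop (1024 * 3 ^ s * (s + d) + 1024 * s)] with n hn
  set m := n / 2 with hm
  set p := n % 2 with hp
  have hnmp : n = 2 * m + p := by omega
  have hp1 : p ≤ 1 := by omega
  -- the deviation `k` satisfies `k ^ 2 ≈ n / (16 * s)`
  set w := m / (8 * s) with hw
  set k := Nat.sqrt w with hk
  have h3 : 1 ≤ 3 ^ s := Nat.one_le_pow _ _ (by norm_num)
  have hsd : s + d ≤ 3 ^ s * (s + d) := Nat.le_mul_of_pos_left _ h3
  have hn1 : 1024 * (s + d) + 1024 * s ≤ n := by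
    refine le_trans ?_ hn
    rw [mul_assoc 1024 (3 ^ s)]
    omega
  have hk1 : k ^ 2 ≤ w := by rw [sq]; exact Nat.sqrt_le w
  have hk2 : w + 1 ≤ (k + 1) ^ 2 := by
    rw [sq]; exact Nat.succ_le_succ_sqrt w
  have hw1 : w * (8 * s) ≤ m := Nat.div_mul_le_self m (8 * s)
  have hw2 : m < (w + 1) * (8 * s) := by
    rw [mul_comm]; exact Nat.lt_mul_div_succ m (by omega)
  have hwpos : 1 ≤ w := (Nat.one_le_div_iff (by omega)).2 (by omega)
  have hkpos : 1 ≤ k := Nat.sqrt_pos.2 hwpos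
  have hkw : k ≤ w := Nat.sqrt_le_self w
  have hkm : 8 * k ≤ m := by
    have : w * 8 ≤ w * (8 * s) := Nat.mul_le_mul_left w (by omega)
    omega
  obtain ⟨ν, hν0, hν1⟩ : ∃ ν : Fin 2 → ℕ, ν 0 = m + p + k ∧ ν 1 = m - k :=
    ⟨![m + p + k, m - k], rfl, rfl⟩
  refine ⟨ν, by rw [Fin.sum_univ_two]; omega, ?_⟩
  have ht0 : turanPart n 2 0 = m + p := by
    unfold turanPart
    simp only [Fin.val_zero]
    split_ifs <;> omega
  have ht1 : turanPart n 2 1 = m := by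
    unfold turanPart
    simp only [Fin.val_one]
    split_ifs <;> omega
  have hn' : (n : ℝ) = 2 * m + p := by exact_mod_cast hnmp
  have hp1' : (p : ℝ) ≤ 1 := by exact_mod_cast hp1
  have hp0 : (0 : ℝ) ≤ p := by positivity
  have hs1 : (1 : ℝ) ≤ s := by exact_mod_cast hs
  have hk1' : (k : ℝ) ^ 2 ≤ w := by exact_mod_cast hk1
  have hk2' : (w : ℝ) + 1 ≤ (k + 1) ^ 2 := by exact_mod_cast hk2
  have hw1' : (w : ℝ) * (8 * s) ≤ m := by exact_mod_cast hw1
  have hw2' : (m : ℝ) < (w + 1) * (8 * s) := by exact_mod_cast hw2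
  have hkpos' : (1 : ℝ) ≤ k := by exact_mod_cast hkpos
  have hn1' : 1024 * (s + d : ℝ) + 1024 * s ≤ n := by exact_mod_cast hn1
  have hnn : 1024 * 3 ^ s * (s + d : ℝ) + 1024 * s ≤ n := by exact_mod_cast hn
  have hm1 : (n : ℝ) ≤ 4 * m := by
    have : (1 : ℝ) ≤ m := by exact_mod_cast (by omega : 1 ≤ m)
    linarith
  rw [partWeight_eq_centeredWeight s d (M := (n / 2 : ℝ)) (κ := (p / 2 : ℝ)) (turanPart n 2)
      (by rw [ht0]; omega) (by rw [ht1]; omega) (by rw [ht0, hn']; push_cast; ring)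
      (by rw [ht1, hn']; ring),
    partWeight_eq_centeredWeight s d (M := (n / 2 : ℝ)) (κ := (k + p / 2 : ℝ))
      ν (by omega) (by omega) (by rw [hν0, hn']; push_cast; ring)
      (by rw [hν1, hn', Nat.cast_sub (by omega)]; ring)]
  have hsq1 : (k : ℝ) ^ 2 ≤ (k + p / 2) ^ 2 := by gcongr; linarith
  have hsq2 : ((k : ℝ) + p / 2) ^ 2 ≤ 9 / 4 * k ^ 2 := by
    calc ((k : ℝ) + p / 2) ^ 2 ≤ (3 / 2 * k) ^ 2 := by gcongr; linarith
      _ = _ := by ring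
  have hsq3 : ((k : ℝ) + 1) ^ 2 ≤ 4 * k ^ 2 := by
    calc ((k : ℝ) + 1) ^ 2 ≤ (2 * k) ^ 2 := by gcongr; linarith
      _ = _ := by ring
  have gain := centeredWeight_gain hs hd (M := (n / 2 : ℝ)) (κ := (k + p / 2 : ℝ))
    (κ₀ := (p / 2 : ℝ)) (by
      have : (0 : ℝ) ≤ 3 ^ s * (s + d) := by positivity
      linarith) (by positivity) (by linarith) (by positivity) (by
      have h1 : (s : ℝ) * (w + 1) ≤ s * (4 * k ^ 2) := by gcongr; linarith
      have h2 : (s : ℝ) * k ^ 2 ≤ s * (k + p / 2) ^ 2 := by gcongr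
      linarith) (by
      have h1 : (s : ℝ) * (k + p / 2) ^ 2 ≤ s * (9 / 4 * w) := by gcongr; linarith
      linarith)
  refine le_trans (le_of_eq ?_) gain
  obtain ⟨q, hq⟩ : ∃ q, 2 * s + d = q + 2 := ⟨2 * s + d - 2, by omega⟩
  rw [hq, Nat.add_sub_cancel]
  have hnpos : (n : ℝ) ≠ 0 := by
    have : 0 < n := by omega
    positivity
  congr 1
  rw [show (n / 2 / 2 : ℝ) = 1 / 4 * n by ring, mul_pow, pow_add (n : ℝ) q 2]
  field_simp
  ring

end Critical

/-! ### The three regimes -/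

section Thresholds

theorem choose_two_lt_of_lt_sqrt {s d : ℕ} (hs : 1 ≤ s)
    (h : ((s + d : ℕ) : ℝ) < s + 1 / 2 + Real.sqrt (2 * s + 1 / 4)) : d.choose 2 < s := by
  rcases Nat.eq_zero_or_pos d with rfl | hd
  · simpa using (by omega : 0 < s)
  have hd' : (1 : ℝ) ≤ d := by exact_mod_cast hd
  push_cast at h
  have h1 : ((d : ℝ) - 1 / 2) ^ 2 < 2 * s + 1 / 4 :=
    (Real.lt_sqrt (by linarith)).1 (by linarith)
  have h2 : ((d.choose 2 : ℕ) : ℝ) < s := by rw [Nat.cast_choose_two]; linarith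
  exact_mod_cast h2

theorem choose_two_eq_of_eq_sqrt {s d : ℕ}
    (h : ((s + d : ℕ) : ℝ) = s + 1 / 2 + Real.sqrt (2 * s + 1 / 4)) : d.choose 2 = s := by
  push_cast at h
  have h1 : ((d : ℝ) - 1 / 2) ^ 2 = 2 * s + 1 / 4 := by
    rw [show (d : ℝ) - 1 / 2 = Real.sqrt (2 * s + 1 / 4) by linarith]
    exact Real.sq_sqrt (by positivity)
  have h2 : ((d.choose 2 : ℕ) : ℝ) = s := by rw [Nat.cast_choose_two]; linarith
  exact_mod_cast h2

theorem mul_lt_two_mul_choose_two_of_sqrt_lt {r s d : ℕ}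
    (h : ((s + d : ℕ) : ℝ) > s + 1 / 2 + Real.sqrt (r * s + 1 / 4)) :
    r * s < 2 * d.choose 2 := by
  push_cast at h
  have h1 : (r : ℝ) * s + 1 / 4 < ((d : ℝ) - 1 / 2) ^ 2 :=
    Real.lt_sq_of_sqrt_lt (by linarith)
  have h2 : (r * s : ℝ) < 2 * (d.choose 2 : ℕ) := by rw [Nat.cast_choose_two]; linarith
  exact_mod_cast h2

theorem turanCount_le_genEx (n k s t : ℕ) :
    turanCount n (k + 1) s t ≤
      genEx n (multipartiteK (k + 1) s t) (⊤ : SimpleGraph (Fin (k + 1 + 1))) := by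
  rw [turanCount, turanGraph_eq_colorGraph n k.succ_pos]
  exact copyCount_le_genEx (free_colorGraph _)

theorem isEquivalent_of_tendsto_div {u v w : ℕ → ℝ} {L : ℝ} (hL : L ≠ 0)
    (hu : Tendsto (fun n => u n / w n) atTop (nhds L))
    (hv : Tendsto (fun n => v n / w n) atTop (nhds L)) : u ~[atTop] v := by
  have hne := hv.eventually_ne hL
  rw [isEquivalent_iff_tendsto_one (hne.mono fun n h h0 => h (by rw [h0, zero_div]))]
  have h := hu.div hv hL
  rw [div_self hL] at h
  refine h.congr' (hne.mono fun n hn => ?_)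
  have hw : w n ≠ 0 := fun h0 => hn (by rw [h0, div_zero])
  exact div_div_div_cancel_right₀ hw _ _

/-- For `d.choose 2 ≤ s`, the Turán graph is asymptotically optimal. -/
theorem isEquivalent_genEx_turanCount {k s d : ℕ} (hs : 1 ≤ s) (hd : d.choose 2 ≤ s) :
    (fun n : ℕ => (genEx n (multipartiteK (k + 1) s (s + d))
      (⊤ : SimpleGraph (Fin (k + 1 + 1))) : ℝ)) ~[atTop]
      fun n : ℕ => (turanCount n (k + 1) s (s + d) : ℝ) := by
  have hC := copyConst_pos k s d
  set f : ℝ := partDensity s d fun _ : Fin (k + 1) => (1 / (k + 1 : ℕ) : ℝ) with hf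
  have hf0 : 0 < f := by
    rw [hf]
    unfold partDensity
    rw [Finset.sum_const, Finset.card_univ, Fintype.card_fin, nsmul_eq_mul]
    positivity
  have hT : Tendsto (fun n : ℕ => (turanCount n (k + 1) s (s + d) : ℝ) /
      (n : ℝ) ^ ((k + 1) * s + d)) atTop (nhds (copyConst k s d * f)) := by
    have h := (tendsto_partWeight_div s d (ν := fun n => turanPart n (k + 1))
      fun i => tendsto_turanPart_div i).const_mul (copyConst k s d)
    rw [Fintype.card_fin] at h
    refine h.congr fun n => ?_
    rw [turanCount_eq n k s d hs, mul_div_assoc]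
  refine isEquivalent_of_tendsto_div (mul_pos hC hf0).ne' ?_ hT
  refine tendsto_of_tendsto_of_tendsto_of_le_of_le' hT tendsto_const_nhds
    (Eventually.of_forall fun n => ?_) ?_
  · have := turanCount_le_genEx n k s (s + d)
    gcongr
  · filter_upwards [eventually_gt_atTop 0] with n hn
    obtain ⟨ν, hν, h⟩ := exists_genEx_eq n k s d hs
    have h1 := partWeight_le_of_sum_eq k.succ_pos hn hs hd hν
    have hn' : (0 : ℝ) < (n : ℝ) ^ ((k + 1) * s + d) := by positivity
    rw [h, div_le_iff₀ hn', mul_assoc, mul_comm f]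
    exact mul_le_mul_of_nonneg_left h1 hC.le

/-- For `r * s < d * (d - 1)`, the Turán graph is not even asymptotically optimal, and it is not
optimal for any `n`; the constant for all `n` comes from combining these two facts. -/
theorem exists_mul_turanCount_le_genEx {k s d : ℕ} (hk : 1 ≤ k) (hs : 1 ≤ s)
    (hd : (k + 1) * s < 2 * d.choose 2) :
    ∃ c : ℝ, 0 < c ∧ ∀ n : ℕ, (1 + c) * (turanCount n (k + 1) s (s + d) : ℝ) ≤
      (genEx n (multipartiteK (k + 1) s (s + d)) (⊤ : SimpleGraph (Fin (k + 1 + 1))) : ℝ) := by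
  have hC := copyConst_pos k s d
  obtain ⟨c, hc, hev⟩ := eventually_exists_mul_partWeight_le (r := k + 1) (by omega) hs hd
  obtain ⟨n₀, hn₀⟩ := eventually_atTop.1 hev
  set S : ℕ := ∑ n ∈ Finset.range n₀, turanCount n (k + 1) s (s + d) with hS
  have hS0 : (0 : ℝ) < S + 1 := by positivity
  refine ⟨min c (1 / (S + 1)), by positivity, fun n => ?_⟩
  have hT0 : (0 : ℝ) ≤ turanCount n (k + 1) s (s + d) := Nat.cast_nonneg _
  rcases le_or_gt n₀ n with hn | hn
  · obtain ⟨ν, hν, h⟩ := hn₀ n hn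
    refine le_trans ?_ (partWeight_le_genEx n k s d hs ν hν)
    calc _ ≤ (1 + c) * (turanCount n (k + 1) s (s + d) : ℝ) := by
            gcongr; exact min_le_left _ _
      _ = copyConst k s d * ((1 + c) * partWeight s d (turanPart n (k + 1))) := by
            rw [turanCount_eq n k s d hs]; ring
      _ ≤ _ := by gcongr
  · rcases Nat.eq_zero_or_pos (turanCount n (k + 1) s (s + d)) with h0 | hpos
    · rw [h0, Nat.cast_zero, mul_zero]
      exact Nat.cast_nonneg _
    · have hpw : 0 < partWeight s d (turanPart n (k + 1)) := by
        have h1 : (0 : ℝ) < turanCount n (k + 1) s (s + d) := by exact_mod_cast hpos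
        rw [turanCount_eq n k s d hs] at h1
        exact_mod_cast pos_of_mul_pos_right h1 hC.le
      obtain ⟨ν, hν, hlt⟩ := exists_partWeight_lt_of_isBalanced (by omega) hs hd
        (isBalanced_turanPart n (k + 1)) hpw
      rw [sum_turanPart n k.succ_pos] at hν
      have h1 := partWeight_le_genEx n k s d hs ν hν
      have h2 : (turanCount n (k + 1) s (s + d) : ℝ) < copyConst k s d * partWeight s d ν := by
        rw [turanCount_eq n k s d hs]
        exact mul_lt_mul_of_pos_left (by exact_mod_cast hlt) hC
      have h3 : turanCount n (k + 1) s (s + d) + 1 ≤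
          genEx n (multipartiteK (k + 1) s (s + d)) (⊤ : SimpleGraph (Fin (k + 1 + 1))) := by
        exact_mod_cast h2.trans_le h1
      have h4 : turanCount n (k + 1) s (s + d) ≤ S :=
        Finset.single_le_sum (f := fun n => turanCount n (k + 1) s (s + d))
          (fun _ _ => Nat.zero_le _) (Finset.mem_range.2 hn)
      have h4' : (turanCount n (k + 1) s (s + d) : ℝ) ≤ S := by exact_mod_cast h4
      have h5 : min c (1 / (S + 1)) * (turanCount n (k + 1) s (s + d) : ℝ) ≤ 1 := by
        calc _ ≤ 1 / (S + 1 : ℝ) * (S + 1) := by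
              gcongr
              · exact min_le_right _ _
              · linarith
          _ = 1 := by field_simp
      have h3' : (turanCount n (k + 1) s (s + d) : ℝ) + 1 ≤
          genEx n (multipartiteK (k + 1) s (s + d)) (⊤ : SimpleGraph (Fin (k + 1 + 1))) := by
        exact_mod_cast h3
      linarith

end Thresholds

end SimpleGraph

theorem theorem5p1 (r s t : ℕ) (hr : 2 ≤ r) (hs : 1 ≤ s) (hst : s ≤ t) :
    ((t : ℝ) < s + 1 / 2 + Real.sqrt (2 * s + 1 / 4) →
      ∀ᶠ n : ℕ in atTop, ∀ G : SimpleGraph (Fin n),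
        ((⊤ : SimpleGraph (Fin (r + 1))).Free G ∧
          G.copyCount (multipartiteK r s t) =
            genEx n (multipartiteK r s t) (⊤ : SimpleGraph (Fin (r + 1)))) ↔
        Nonempty (G ≃g SimpleGraph.turanGraph n r)) ∧
    ((t : ℝ) = s + 1 / 2 + Real.sqrt (2 * s + 1 / 4) →
      ((fun n : ℕ =>
          (genEx n (multipartiteK r s t) (⊤ : SimpleGraph (Fin (r + 1))) : ℝ)) ~[atTop]
        fun n : ℕ => (turanCount n r s t : ℝ)) ∧
      (r = 2 →
        ∃ c : ℝ, 0 < c ∧ ∀ᶠ n : ℕ in atTop,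
          (turanCount n r s t : ℝ) + c * (n : ℝ) ^ (s + t - 2) ≤
            (genEx n (multipartiteK r s t) (⊤ : SimpleGraph (Fin (r + 1))) : ℝ))) ∧
    ((t : ℝ) > s + 1 / 2 + Real.sqrt (r * s + 1 / 4) →
      ∃ c : ℝ, 0 < c ∧ ∀ n : ℕ,
        (1 + c) * (turanCount n r s t : ℝ) ≤
          (genEx n (multipartiteK r s t) (⊤ : SimpleGraph (Fin (r + 1))) : ℝ)) := by
  obtain ⟨d, rfl⟩ := Nat.exists_eq_add_of_le hst
  obtain ⟨k, rfl⟩ : ∃ k, r = k + 1 := ⟨r - 1, by omega⟩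
  refine ⟨fun h => ?_, fun h => ⟨?_, fun hk => ?_⟩, fun h => ?_⟩
  · filter_upwards [SimpleGraph.eventually_exists_partWeight_lt (k + 1) hs
        (SimpleGraph.choose_two_lt_of_lt_sqrt hs h),
      eventually_ge_atTop ((k + 1) * (s + d + 1))] with n hopt hn G
    rw [← SimpleGraph.isCopyMaximal_iff]
    exact SimpleGraph.isCopyMaximal_iff_nonempty_iso hs hn hopt G
  · exact SimpleGraph.isEquivalent_genEx_turanCount hs (SimpleGraph.choose_two_eq_of_eq_sqrt h).le
  · obtain rfl : k = 1 := by omega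
    obtain ⟨c, hc, hev⟩ := SimpleGraph.exists_partWeight_add_le hs (SimpleGraph.choose_two_eq_of_eq_sqrt h)
    have hC := SimpleGraph.copyConst_pos 1 s d
    refine ⟨SimpleGraph.copyConst 1 s d * c, mul_pos hC hc, ?_⟩
    filter_upwards [hev] with n hn
    obtain ⟨ν, hν, h⟩ := hn
    refine le_trans ?_ (SimpleGraph.partWeight_le_genEx n 1 s d hs ν hν)
    rw [SimpleGraph.turanCount_eq n 1 s d hs, show s + (s + d) - 2 = 2 * s + d - 2 by omega, mul_assoc,
      ← mul_add]
    exact mul_le_mul_of_nonneg_left h hC.le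
  · exact SimpleGraph.exists_mul_turanCount_le_genEx (by omega) hs
      (SimpleGraph.mul_lt_two_mul_choose_two_of_sqrt_lt h)
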